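/- Let $k$ be a unital commutative ring, $\delta\in k$ and $n\ge 0$ an integer. A partition $n$-diagram is a partition of the set of $2n$ vertices $\{1,\dots,n\}\sqcup\{\bar 1,\dots,\bar n\}$ (a left and a right column); its blocks are called components. The partition algebra $P_n(\delta)$ is the $k$-algebra with basis the partition $n$-diagrams and product $d_1d_2=\delta^{\alpha}d_3$, where $d_2$ is placed to the right of $d_1$, the right column of $d_1$ is identified with the left column of $d_2$, $\alpha$ is the number of components of the resulting three-column diagram that lie entirely in the middle column, and $d_3$ is the partition induced on the two outer columns. For a component $C$ let $L(C)$ and $R(C)$ be its numbers of left and right vertices, and call $C$ propagating if $L(C),R(C)\ge 1$. Consider the following subalgebras of $P_n(\delta)$, spanned $k$-linearly by diagrams: * for an integer $r\ge 1$, the Tanabe algebra $\mathcal T_n(\delta,r)$, spanned by the diagrams with $|L(C)-R(C)|\equiv 0 \pmod r$ for every component $C$; * the totally propagating partition algebra $TPP_n$, spanned by the diagrams all of whose components are propagating; * the uniform block permutation algebra $U_n$, spanned by the diagrams with $L(C)=R(C)$ for every component $C$. Each of these algebras is augmented by the $k$-algebra map to $k$ that sends the diagrams with exactly $n$ propagating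 components (the permutation diagrams) to $1$ and all other diagrams to $0$. Let $\mathbb 1$ denote $k$ with the algebra acting (on the left or on the right) through the augmentation, and also $k$ with trivial action of the symmetric group $\Sigma_n$. In $\operatorname{Tor}^A_\star(\mathbb 1,\mathbb 1)$ the first argument is the right module and the second the left module; $\operatorname{Ext}_A^\star(\mathbb 1,\mathbb 1)$ is formed in the category of right $A$-modules. **Theorem.** Let $r\ge 2$. There are isomorphisms of graded $k$-modules 1. $\operatorname{Tor}_\star^{\mathcal T_n(\delta,r)}(\mathbb 1,\mathbb 1)\cong H_\star(\Sigma_n,\mathbb 1)$ and $\operatorname{Ext}^\star_{\mathcal T_n(\delta,r)}(\mathbb 1,\mathbb 1)\cong H^\star(\Sigma_n,\mathbb 1)$; 2. $\operatorname{Tor}_\star^{TPP_n}(\mathbb 1,\mathbb 1)\cong H_\star(\Sigma_n,\mathbb 1)$ and $\operatorname{Ext}^\star_{TPP_n}(\mathbb 1,\mathbb 1)\cong H^\star(\Sigma_n,\mathbb 1)$; 3. $\operatorname{Tor}_\star^{U_n}(\mathbb 1,\mathbb 1)\cong H_\star(\Sigma_n,\mathbb 1)$ and $\operatorname{Ext}^\star_{U_n}(\mathbb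 1,\mathbb 1)\cong H^\star(\Sigma_n,\mathbb 1)$. -/

import Mathlib

universe u

namespace TanabeCohomology

/-! ### Partition diagrams -/

/-- A partition `n`-diagram (up to equivalence): a partition of the set of `2n` vertices, given as
an equivalence relation.  `Sum.inl i` is the vertex `i` of the left-hand column and `Sum.inr i` is
the vertex `i` of the right-hand column.  The connected components of `d` are the elements of
`Setoid.classes d`. -/
abbrev Diagram (n : ℕ) := Setoid (Fin n ⊕ Fin n)

/-- The vertices of two diagrams placed side by side: left, middle and right columns. -/
abbrev ThreeCol (n : ℕ) := Fin n ⊕ Fin n ⊕ Fin n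

/-- The left and middle columns inside the three columns. -/
def leftMid {n : ℕ} : Fin n ⊕ Fin n → ThreeCol n :=
  Sum.elim Sum.inl (fun j => Sum.inr (Sum.inl j))

/-- The middle and right columns inside the three columns. -/
def midRight {n : ℕ} : Fin n ⊕ Fin n → ThreeCol n :=
  Sum.elim (fun j => Sum.inr (Sum.inl j)) (fun l => Sum.inr (Sum.inr l))

/-- The left and right columns inside the three columns. -/
def leftRight {n : ℕ} : Fin n ⊕ Fin n → ThreeCol n :=
  Sum.elim Sum.inl (fun l => Sum.inr (Sum.inr l))

/-- The three-column diagram `d₁ ∗ d₂`: the connectivity relation of `d₁` placed to the left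
of `d₂`, with the right column of `d₁` identified with the left column of `d₂`. -/
def stack {n : ℕ} (d₁ d₂ : Diagram n) : Setoid (ThreeCol n) :=
  d₁.map leftMid ⊔ d₂.map midRight

/-- The number of components (classes of `T`) that contain no element of the image of `f`. -/
noncomputable def hidden {S V : Type} (f : S → V) (T : Setoid V) : ℕ :=
  {C ∈ T.classes | ∀ s, f s ∉ C}.ncard

/-- The number `α` of components of `d₁ ∗ d₂` lying entirely within the middle column, that is,
containing no vertex of the two outer columns. -/
noncomputable def midCount {n : ℕ} (d₁ d₂ : Diagram n) : ℕ :=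
  hidden leftRight (stack d₁ d₂)

/-- The diagram `d₃` underlying the product `d₁ d₂ = δ ^ α • d₃`. -/
@[reducible] def comp {n : ℕ} (d₁ d₂ : Diagram n) : Diagram n :=
  (stack d₁ d₂).comap leftRight

/-- The diagram with blocks `{i, \bar{σ i}}`. -/
@[reducible] def permDiagram {n : ℕ} (σ : Equiv.Perm (Fin n)) : Diagram n :=
  Setoid.ker (Sum.elim σ id)

/-- The identity diagram, with `n` horizontal edges. -/
@[reducible] def idDiagram (n : ℕ) : Diagram n := permDiagram 1

/-- The number of left-hand vertices in a set of vertices. -/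
noncomputable def leftCard {n : ℕ} (C : Set (Fin n ⊕ Fin n)) : ℕ := {i | Sum.inl i ∈ C}.ncard

/-- The number of right-hand vertices in a set of vertices. -/
noncomputable def rightCard {n : ℕ} (C : Set (Fin n ⊕ Fin n)) : ℕ := {i | Sum.inr i ∈ C}.ncard

/-- `κ(C) = |L(C) - R(C)|`. -/
noncomputable def kappa {n : ℕ} (C : Set (Fin n ⊕ Fin n)) : ℕ :=
  ((leftCard C : ℤ) - (rightCard C : ℤ)).natAbs

/-- A set of vertices is propagating if it meets both columns. -/
def IsPropagating {n : ℕ} (C : Set (Fin n ⊕ Fin n)) : Prop :=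
  (∃ i, Sum.inl i ∈ C) ∧ ∃ j, Sum.inr j ∈ C

/-- The number of propagating components of a diagram. -/
noncomputable def propCount {n : ℕ} (d : Diagram n) : ℕ :=
  {C ∈ d.classes | IsPropagating C}.ncard

/-- A permutation diagram is one with precisely `n` propagating components. -/
def IsPermutation {n : ℕ} (d : Diagram n) : Prop := propCount d = n

/-- `κ(C) ≡ 0 (mod r)` for every component `C`. -/
def IsTanabe {n : ℕ} (r : ℕ) (d : Diagram n) : Prop :=
  ∀ C ∈ d.classes, kappa C ≡ 0 [MOD r]

/-- Every component is propagating. -/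
def IsTotallyPropagating {n : ℕ} (d : Diagram n) : Prop :=
  ∀ C ∈ d.classes, IsPropagating C

/-- Every component has as many left-hand as right-hand vertices. -/
def IsUniform {n : ℕ} (d : Diagram n) : Prop :=
  ∀ C ∈ d.classes, leftCard C = rightCard C

/-! ### Facts on setoids needed for associativity -/

section Setoids

variable {S V W U P O : Type}

theorem map_le_iff {f : S → V} {A : Setoid S} {Q : Setoid V} :
    A.map f ≤ Q ↔ A ≤ Q.comap f := by
  constructor
  · intro h
    exact le_trans Setoid.le_comap_map (fun x y hxy => h hxy)
  · intro h
    refine Setoid.eqvGen_le ?_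
    rintro _ _ ⟨a, b, hab, rfl, rfl⟩
    exact h hab

theorem map_sup (f : S → V) (A B : Setoid S) : (A ⊔ B).map f = A.map f ⊔ B.map f := by
  apply le_antisymm
  · rw [map_le_iff]
    exact sup_le (map_le_iff.1 le_sup_left) (map_le_iff.1 le_sup_right)
  · exact sup_le (map_le_iff.2 (le_trans le_sup_left Setoid.le_comap_map))
      (map_le_iff.2 (le_trans le_sup_right Setoid.le_comap_map))

theorem map_map (f : S → V) (g : V → W) (A : Setoid S) : (A.map f).map g = A.map (g ∘ f) := by
  apply le_antisymm
  · rw [map_le_iff, map_le_iff]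
    exact (Setoid.le_comap_map : A ≤ (A.map (g ∘ f)).comap (g ∘ f))
  · rw [map_le_iff]
    have h : A.map f ≤ ((A.map f).map g).comap g := Setoid.le_comap_map
    exact (map_le_iff.1 h : A ≤ (((A.map f).map g).comap g).comap f)

theorem map_rel_of_injective {f : S → V} (hf : Function.Injective f) (A : Setoid S) {x y : V} :
    A.map f x y ↔ (∃ a b, A a b ∧ f a = x ∧ f b = y) ∨ x = y := by
  rw [Setoid.coe_map_of_ker_le A f (by rw [Setoid.ker_eq_bot_iff.2 hf]; exact bot_le)]
  rfl

theorem sup_map_rel (f : S → V) (A : Setoid V) (B : Setoid S) {x y : V}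
    (h : (A ⊔ B.map f) x y) :
    A x y ∨ ∃ s t, A x (f s) ∧ (A.comap f ⊔ B) s t ∧ A (f t) y := by
  let E : Setoid V :=
    { r := fun x y => A x y ∨ ∃ s t, A x (f s) ∧ (A.comap f ⊔ B) s t ∧ A (f t) y
      iseqv :=
        { refl := fun x => Or.inl (A.refl' x)
          symm := by
            rintro x y (h | ⟨s, t, h1, h2, h3⟩)
            · exact Or.inl (A.symm' h)
            · exact Or.inr ⟨t, s, A.symm' h3, Setoid.symm' _ h2, A.symm' h1⟩
          trans := by
            rintro x y z (h | ⟨s, t, h1, h2, h3⟩) (h' | ⟨s', t', h1', h2', h3'⟩)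
            · exact Or.inl (A.trans' h h')
            · exact Or.inr ⟨s', t', A.trans' h h1', h2', h3'⟩
            · exact Or.inr ⟨s, t, h1, h2, A.trans' h3 h'⟩
            · refine Or.inr ⟨s, t', h1, Setoid.trans' _ h2 (Setoid.trans' _ ?_ h2'), h3'⟩
              exact (le_sup_left : A.comap f ≤ A.comap f ⊔ B) (A.trans' h3 h1') } }
  have hE : A ⊔ B.map f ≤ E := by
    refine sup_le (fun x y h => Or.inl h) (map_le_iff.2 ?_)
    intro s t hst
    exact Or.inr ⟨s, t, A.refl' _, (le_sup_right : B ≤ A.comap f ⊔ B) hst, A.refl' _⟩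
  exact hE h

theorem comap_sup_map (f : S → V) (A : Setoid V) (B : Setoid S) :
    (A ⊔ B.map f).comap f = A.comap f ⊔ B := by
  apply le_antisymm
  · intro s t h
    rcases sup_map_rel f A B h with h | ⟨s', t', h1, h2, h3⟩
    · exact (le_sup_left : A.comap f ≤ A.comap f ⊔ B) h
    · exact Setoid.trans' _ ((le_sup_left : A.comap f ≤ A.comap f ⊔ B) h1)
        (Setoid.trans' _ h2 ((le_sup_left : A.comap f ≤ A.comap f ⊔ B) h3))
  · exact sup_le (fun s t h => (le_sup_left : A ≤ A ⊔ B.map f) h)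
      (map_le_iff.1 le_sup_right)

theorem comap_map_pullback {g : U → V} {f : S → V} {p : P → U} {q : P → S}
    (hg : Function.Injective g) (hf : Function.Injective f) (hsq : ∀ x, g (p x) = f (q x))
    (hpb : ∀ a s, g a = f s → ∃ x, p x = a ∧ q x = s) (T : Setoid U) :
    (T.map g).comap f = (T.comap p).map q := by
  apply le_antisymm
  · intro s t h
    rw [Setoid.comap_rel, map_rel_of_injective hg] at h
    rcases h with ⟨a, b, hab, ha, hb⟩ | h
    · obtain ⟨x, rfl, rfl⟩ := hpb a s ha
      obtain ⟨y, rfl, rfl⟩ := hpb b t hb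
      exact (map_le_iff.1 (le_refl ((T.comap p).map q))) hab
    · rw [hf h]
  · rw [map_le_iff]
    intro x y h
    change (T.map g) (f (q x)) (f (q y))
    rw [← hsq, ← hsq]
    exact (map_le_iff.1 (le_refl (T.map g))) h

theorem class_eq {T : Setoid V} {C : Set V} (hC : C ∈ T.classes) {x : V} (hx : x ∈ C) :
    C = {y | T y x} :=
  Setoid.eq_of_mem_classes hC hx (T.mem_classes x) (T.refl' x)

theorem mem_class_iff {T : Setoid V} {C : Set V} (hC : C ∈ T.classes) {x y : V} (hx : x ∈ C) :
    y ∈ C ↔ T y x := by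
  rw [class_eq hC hx]
  rfl

theorem class_nonempty {T : Setoid V} {C : Set V} (hC : C ∈ T.classes) : ∃ x, x ∈ C := by
  obtain ⟨x, rfl⟩ := hC
  exact ⟨x, T.refl' x⟩

theorem hidden_map {g : U → V} {f : S → V} {p : P → U} {q : P → S}
    (hg : Function.Injective g) (hsq : ∀ x, g (p x) = f (q x))
    (hpb : ∀ a s, g a = f s → ∃ x, p x = a ∧ q x = s)
    (hcov : ∀ v, (∃ a, g a = v) ∨ ∃ s, f s = v) (T : Setoid U) :
    hidden f (T.map g) = hidden p T := by
  have key : ∀ a v, (T.map g) v (g a) ↔ ∃ b, T b a ∧ g b = v := by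
    intro a v
    rw [map_rel_of_injective hg]
    constructor
    · rintro (⟨b, c, hbc, rfl, hc⟩ | rfl)
      · rw [hg hc] at hbc
        exact ⟨b, hbc, rfl⟩
      · exact ⟨a, T.refl' a, rfl⟩
    · rintro ⟨b, hb, rfl⟩
      exact Or.inl ⟨b, a, hb, rfl, rfl⟩
  unfold hidden
  symm
  rw [← Set.ncard_image_of_injective _ hg.image_injective]
  congr 1
  ext D
  constructor
  · rintro ⟨C, ⟨⟨a, rfl⟩, hC⟩, rfl⟩
    refine ⟨⟨g a, ?_⟩, ?_⟩
    · ext v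
      simp only [Set.mem_image, Set.mem_ofPred_eq, key]
    · rintro s ⟨b, hb, hbs⟩
      obtain ⟨x, rfl, rfl⟩ := hpb b s hbs
      exact hC x hb
  · rintro ⟨⟨v, rfl⟩, hD⟩
    rcases hcov v with ⟨a, rfl⟩ | ⟨s, rfl⟩
    · refine ⟨{b | T b a}, ⟨T.mem_classes a, ?_⟩, ?_⟩
      · intro x hx
        refine hD (q x) ?_
        rw [← hsq]
        exact (key a _).2 ⟨p x, hx, rfl⟩
      · ext v
        simp only [Set.mem_image, Set.mem_ofPred_eq, key]
    · exact absurd (Setoid.refl' (T.map g) (f s)) (hD s)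

theorem hidden_split [Finite V] (f : S → V) (g : O → S) (A : Setoid V) (B : Setoid S) :
    hidden (f ∘ g) (A ⊔ B.map f) = hidden f A + hidden g ((A ⊔ B.map f).comap f) := by
  set Q := A ⊔ B.map f with hQ
  have hAQ : A ≤ Q := le_sup_left
  have h1 : {C ∈ A.classes | ∀ s, f s ∉ C} = {C ∈ Q.classes | ∀ s, f s ∉ C} := by
    ext C
    constructor
    · rintro ⟨⟨x, rfl⟩, hC⟩
      refine ⟨⟨x, ?_⟩, hC⟩
      ext y
      refine ⟨fun h => hAQ h, fun h => ?_⟩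
      rcases sup_map_rel f A B h with h | ⟨s, t, _, _, h3⟩
      · exact h
      · exact absurd h3 (hC t)
    · rintro ⟨⟨x, rfl⟩, hC⟩
      refine ⟨⟨x, ?_⟩, hC⟩
      ext y
      refine ⟨fun h => ?_, fun h => hAQ h⟩
      rcases sup_map_rel f A B h with h | ⟨s, t, _, _, h3⟩
      · exact h
      · exact absurd (hAQ h3) (hC t)
  have h2 : {C ∈ Q.classes | ∀ o, (f ∘ g) o ∉ C} = {C ∈ Q.classes | ∀ s, f s ∉ C} ∪
      {C ∈ Q.classes | (∃ s, f s ∈ C) ∧ ∀ o, f (g o) ∉ C} := by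
    ext C
    constructor
    · rintro ⟨hC, h⟩
      by_cases hs : ∃ s, f s ∈ C
      · exact Or.inr ⟨hC, hs, h⟩
      · exact Or.inl ⟨hC, fun s hs' => hs ⟨s, hs'⟩⟩
    · rintro (⟨hC, h⟩ | ⟨hC, _, h⟩)
      · exact ⟨hC, fun o => h _⟩
      · exact ⟨hC, h⟩
  have h3 : {C ∈ Q.classes | (∃ s, f s ∈ C) ∧ ∀ o, f (g o) ∉ C}.ncard =
      {C ∈ (Q.comap f).classes | ∀ o, g o ∉ C}.ncard := by
    refine Set.ncard_congr (fun C _ => f ⁻¹' C) ?_ ?_ ?_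
    · rintro C ⟨hC, ⟨s, hs⟩, ho⟩
      refine ⟨⟨s, ?_⟩, ho⟩
      ext t
      exact mem_class_iff hC hs
    · rintro C D ⟨hC, ⟨s, hs⟩, _⟩ ⟨hD, _, _⟩ hCD
      have hs' : s ∈ f ⁻¹' D := hCD ▸ hs
      exact Setoid.eq_of_mem_classes hC hs hD hs'
    · rintro D ⟨⟨s, rfl⟩, ho⟩
      exact ⟨{v | Q v (f s)}, ⟨Q.mem_classes _, ⟨s, Q.refl' _⟩, ho⟩, rfl⟩
  unfold hidden
  rw [h1, h2, Set.ncard_union_eq, h3]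
  · rw [Set.disjoint_left]
    rintro C ⟨_, h⟩ ⟨_, ⟨s, hs⟩, _⟩
    exact h s hs

end Setoids

/-! ### Composition of diagrams is associative and unital -/

section Composition

variable {n : ℕ}

/-- Four columns of vertices. -/
abbrev FourCol (n : ℕ) := Fin n ⊕ Fin n ⊕ Fin n ⊕ Fin n

/-- Columns one, two and three among four. -/
def col123 : ThreeCol n → FourCol n :=
  Sum.elim Sum.inl (Sum.elim (fun j => Sum.inr (Sum.inl j)) (fun l => Sum.inr (Sum.inr (Sum.inl l))))

/-- Columns one, two and four among four. -/
def col124 : ThreeCol n → FourCol n :=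
  Sum.elim Sum.inl (Sum.elim (fun j => Sum.inr (Sum.inl j)) (fun l => Sum.inr (Sum.inr (Sum.inr l))))

/-- Columns one, three and four among four. -/
def col134 : ThreeCol n → FourCol n :=
  Sum.elim Sum.inl (Sum.elim (fun j => Sum.inr (Sum.inr (Sum.inl j)))
    (fun l => Sum.inr (Sum.inr (Sum.inr l))))

/-- Columns two, three and four among four. -/
def col234 : ThreeCol n → FourCol n := Sum.inr

theorem col123_injective : Function.Injective (col123 (n := n)) := by
  rintro (x | x | x) (y | y | y) h <;> simp_all [col123]

theorem col124_injective : Function.Injective (col124 (n := n)) := by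
  rintro (x | x | x) (y | y | y) h <;> simp_all [col124]

theorem col134_injective : Function.Injective (col134 (n := n)) := by
  rintro (x | x | x) (y | y | y) h <;> simp_all [col134]

theorem col234_injective : Function.Injective (col234 (n := n)) := Sum.inr_injective

theorem sq_left (x : Fin n ⊕ Fin n) : col123 (leftRight x) = col134 (leftMid x) := by
  rcases x with x | x <;> rfl

theorem pb_left (a s : ThreeCol n) (h : col123 a = col134 s) :
    ∃ x, leftRight x = a ∧ leftMid x = s := by
  rcases a with a | a | a <;> rcases s with s | s | s <;> simp [col123, col134] at h
  · subst h; exact ⟨Sum.inl a, rfl, rfl⟩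
  · subst h; exact ⟨Sum.inr a, rfl, rfl⟩

theorem cov_left (v : FourCol n) : (∃ a, col123 a = v) ∨ ∃ s, col134 s = v := by
  rcases v with v | v | v | v
  · exact Or.inl ⟨Sum.inl v, rfl⟩
  · exact Or.inl ⟨Sum.inr (Sum.inl v), rfl⟩
  · exact Or.inl ⟨Sum.inr (Sum.inr v), rfl⟩
  · exact Or.inr ⟨Sum.inr (Sum.inr v), rfl⟩

theorem sq_right (x : Fin n ⊕ Fin n) : col234 (leftRight x) = col124 (midRight x) := by
  rcases x with x | x <;> rfl

theorem pb_right (a s : ThreeCol n) (h : col234 a = col124 s) :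
    ∃ x, leftRight x = a ∧ midRight x = s := by
  rcases a with a | a | a <;> rcases s with s | s | s <;> simp [col234, col124] at h
  · subst h; exact ⟨Sum.inl a, rfl, rfl⟩
  · subst h; exact ⟨Sum.inr a, rfl, rfl⟩

theorem cov_right (v : FourCol n) : (∃ a, col234 a = v) ∨ ∃ s, col124 s = v := by
  rcases v with v | v | v | v
  · exact Or.inr ⟨Sum.inl v, rfl⟩
  · exact Or.inl ⟨Sum.inl v, rfl⟩
  · exact Or.inl ⟨Sum.inr (Sum.inl v), rfl⟩
  · exact Or.inl ⟨Sum.inr (Sum.inr v), rfl⟩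

/-- The connectivity relation of three diagrams placed side by side. -/
def stack₃ (d₁ d₂ d₃ : Diagram n) : Setoid (FourCol n) :=
  (stack d₁ d₂).map col123 ⊔ (d₃.map midRight).map col134

theorem stack₃_eq (d₁ d₂ d₃ : Diagram n) :
    stack₃ d₁ d₂ d₃ = (stack d₂ d₃).map col234 ⊔ (d₁.map leftMid).map col124 := by
  have e1 : (col123 ∘ leftMid : Fin n ⊕ Fin n → FourCol n) = col124 ∘ leftMid := by
    funext x; rcases x with x | x <;> rfl
  have e2 : (col123 ∘ midRight : Fin n ⊕ Fin n → FourCol n) = col234 ∘ leftMid := by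
    funext x; rcases x with x | x <;> rfl
  have e3 : (col134 ∘ midRight : Fin n ⊕ Fin n → FourCol n) = col234 ∘ midRight := by
    funext x; rcases x with x | x <;> rfl
  simp only [stack₃, stack, map_sup, map_map]
  rw [e1, e2, e3]
  ac_rfl

theorem comap_stack₃_left (d₁ d₂ d₃ : Diagram n) :
    (stack₃ d₁ d₂ d₃).comap col134 = stack (comp d₁ d₂) d₃ := by
  rw [stack₃, comap_sup_map, comap_map_pullback col123_injective col134_injective sq_left pb_left]
  rfl

theorem comap_stack₃_right (d₁ d₂ d₃ : Diagram n) :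
    (stack₃ d₁ d₂ d₃).comap col124 = stack d₁ (comp d₂ d₃) := by
  rw [stack₃_eq, comap_sup_map,
    comap_map_pullback col234_injective col124_injective sq_right pb_right, sup_comm]
  rfl

theorem col_outer : (col134 ∘ leftRight : Fin n ⊕ Fin n → FourCol n) = col124 ∘ leftRight := by
  funext x; rcases x with x | x <;> rfl

theorem comp_assoc (d₁ d₂ d₃ : Diagram n) : comp (comp d₁ d₂) d₃ = comp d₁ (comp d₂ d₃) := by
  change (stack (comp d₁ d₂) d₃).comap leftRight = (stack d₁ (comp d₂ d₃)).comap leftRight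
  rw [← comap_stack₃_left, ← comap_stack₃_right]
  change (stack₃ d₁ d₂ d₃).comap (col134 ∘ leftRight) = _
  rw [col_outer]
  rfl

theorem midCount_assoc (d₁ d₂ d₃ : Diagram n) :
    midCount d₁ d₂ + midCount (comp d₁ d₂) d₃ = midCount d₂ d₃ + midCount d₁ (comp d₂ d₃) := by
  have h1 := hidden_split (col134 (n := n)) leftRight ((stack d₁ d₂).map col123) (d₃.map midRight)
  have h2 := hidden_split (col124 (n := n)) leftRight ((stack d₂ d₃).map col234) (d₁.map leftMid)
  rw [hidden_map col123_injective sq_left pb_left cov_left] at h1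
  rw [hidden_map col234_injective sq_right pb_right cov_right] at h2
  rw [← stack₃_eq, comap_stack₃_right] at h2
  change hidden _ (stack₃ d₁ d₂ d₃) = _ + hidden _ ((stack₃ d₁ d₂ d₃).comap col134) at h1
  rw [comap_stack₃_left, col_outer, h2] at h1
  exact h1.symm

theorem stack_left {d₁ d₂ : Diagram n} {x y : Fin n ⊕ Fin n} (h : d₁ x y) :
    stack d₁ d₂ (leftMid x) (leftMid y) :=
  (map_le_iff.1 (le_sup_left : d₁.map leftMid ≤ stack d₁ d₂)) h

theorem stack_right {d₁ d₂ : Diagram n} {x y : Fin n ⊕ Fin n} (h : d₂ x y) :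
    stack d₁ d₂ (midRight x) (midRight y) :=
  (map_le_iff.1 (le_sup_right : d₂.map midRight ≤ stack d₁ d₂)) h

theorem stack_le {d₁ d₂ : Diagram n} {Q : Setoid (ThreeCol n)} (h₁ : d₁ ≤ Q.comap leftMid)
    (h₂ : d₂ ≤ Q.comap midRight) : stack d₁ d₂ ≤ Q :=
  sup_le (map_le_iff.2 h₁) (map_le_iff.2 h₂)

theorem permDiagram_rel (σ : Equiv.Perm (Fin n)) (i : Fin n) :
    permDiagram σ (Sum.inl i) (Sum.inr (σ i)) := rfl

theorem midCount_eq_zero_of {d₁ d₂ : Diagram n}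
    (h : ∀ j, ∃ x, stack d₁ d₂ (leftRight x) (Sum.inr (Sum.inl j))) : midCount d₁ d₂ = 0 := by
  unfold midCount hidden
  convert Set.ncard_empty (Set (ThreeCol n))
  rw [Set.eq_empty_iff_forall_notMem]
  rintro C ⟨hC, hno⟩
  obtain ⟨x, hx⟩ := class_nonempty hC
  rcases x with x | x | x
  · exact hno (Sum.inl x) hx
  · obtain ⟨y, hy⟩ := h x
    exact hno y ((mem_class_iff hC hx).2 hy)
  · exact hno (Sum.inr x) hx

theorem midCount_perm_left (σ : Equiv.Perm (Fin n)) (d : Diagram n) :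
    midCount (permDiagram σ) d = 0 := by
  refine midCount_eq_zero_of fun j => ⟨Sum.inl (σ.symm j), ?_⟩
  have := stack_left (d₂ := d) (permDiagram_rel σ (σ.symm j))
  rwa [σ.apply_symm_apply] at this

theorem midCount_perm_right (σ : Equiv.Perm (Fin n)) (d : Diagram n) :
    midCount d (permDiagram σ) = 0 := by
  refine midCount_eq_zero_of fun j => ⟨Sum.inr (σ j), ?_⟩
  exact Setoid.symm' _ (stack_right (d₁ := d) (permDiagram_rel σ j))

theorem id_comp (d : Diagram n) : comp (idDiagram n) d = d := by
  have hl : ∀ x : Fin n ⊕ Fin n, stack (idDiagram n) d (leftRight x) (midRight x) := by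
    rintro (i | i)
    · exact stack_left (permDiagram_rel 1 i)
    · exact Setoid.refl' _ _
  apply le_antisymm
  · have h : stack (idDiagram n) d ≤
        d.comap (Sum.elim Sum.inl (Sum.elim Sum.inl Sum.inr) : ThreeCol n → Fin n ⊕ Fin n) := by
      refine stack_le ?_ ?_
      · rintro (i | i) (j | j) h <;> obtain rfl : i = j := h <;> exact d.refl' _
      · rintro (i | i) (j | j) h <;> exact h
    rintro (i | i) (j | j) hxy <;> exact h hxy
  · intro x y hxy
    change stack _ _ (leftRight x) (leftRight y)
    exact Setoid.trans' _ (hl x) (Setoid.trans' _ (stack_right hxy) (Setoid.symm' _ (hl y)))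

theorem comp_id (d : Diagram n) : comp d (idDiagram n) = d := by
  have hl : ∀ x : Fin n ⊕ Fin n, stack d (idDiagram n) (leftRight x) (leftMid x) := by
    rintro (i | i)
    · exact Setoid.refl' _ _
    · exact Setoid.symm' _ (stack_right (permDiagram_rel 1 i))
  apply le_antisymm
  · have h : stack d (idDiagram n) ≤
        d.comap (Sum.elim Sum.inl (Sum.elim Sum.inr Sum.inr) : ThreeCol n → Fin n ⊕ Fin n) := by
      refine stack_le ?_ ?_
      · rintro (i | i) (j | j) h <;> exact h
      · rintro (i | i) (j | j) h <;> obtain rfl : i = j := h <;> exact d.refl' _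
    rintro (i | i) (j | j) hxy <;> exact h hxy
  · intro x y hxy
    change stack _ _ (leftRight x) (leftRight y)
    exact Setoid.trans' _ (hl x) (Setoid.trans' _ (stack_left hxy) (Setoid.symm' _ (hl y)))

end Composition

/-! ### Closure properties of the families of diagrams -/

section Closure

variable {n : ℕ}

theorem leftCard_sub_rightCard (E : Set (Fin n ⊕ Fin n)) [DecidablePred (· ∈ E)] :
    (leftCard E : ℤ) - rightCard E =
      ∑ v, if v ∈ E then (Sum.elim (fun _ => 1) (fun _ => -1) v : ℤ) else 0 := by
  rw [Fintype.sum_sum_type]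
  simp only [Sum.elim_inl, Sum.elim_inr, leftCard, rightCard]
  rw [Set.ncard_eq_toFinset_card', Set.ncard_eq_toFinset_card']
  simp only [Finset.sum_ite, Finset.sum_const, smul_zero, add_zero, nsmul_eq_mul, mul_one,
    mul_neg, Set.toFinset_ofPred]
  rfl

theorem isTanabe_iff {r : ℕ} {d : Diagram n} :
    IsTanabe r d ↔ ∀ C ∈ d.classes, (r : ℤ) ∣ (leftCard C : ℤ) - rightCard C := by
  unfold IsTanabe kappa
  simp only [Nat.modEq_zero_iff_dvd, Int.natCast_dvd]

theorem isUniform_iff {d : Diagram n} : IsUniform d ↔ IsTanabe 0 d := by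
  rw [isTanabe_iff]
  simp only [IsUniform, Nat.cast_zero, zero_dvd_iff, sub_eq_zero, Nat.cast_inj]

theorem IsTanabe.dvd_of_saturated {r : ℕ} {d : Diagram n} (hd : IsTanabe r d)
    {E : Set (Fin n ⊕ Fin n)} (hE : ∀ x y, d x y → (x ∈ E ↔ y ∈ E)) :
    (r : ℤ) ∣ (leftCard E : ℤ) - rightCard E := by
  classical
  rw [isTanabe_iff] at hd
  rw [leftCard_sub_rightCard,
    ← Finset.sum_fiberwise Finset.univ (fun v => (Quotient.mk d v : Quotient d))]
  refine Finset.dvd_sum fun q _ => ?_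
  obtain ⟨x, rfl⟩ := Quotient.exists_rep q
  by_cases hx : x ∈ E
  · have h := hd _ (d.mem_classes x)
    rw [leftCard_sub_rightCard, ← Finset.sum_filter] at h
    refine dvd_trans h (dvd_of_eq (Eq.symm ?_))
    have hfil : ∀ v, (Quotient.mk d v = Quotient.mk d x) ↔ v ∈ {y | d y x} := fun v => Quotient.eq
    have hset : Finset.univ.filter (fun v => Quotient.mk d v = Quotient.mk d x) =
        Finset.univ.filter (fun v => v ∈ {y | d y x}) :=
      Finset.filter_congr fun v _ => hfil v
    rw [hset]
    refine Finset.sum_congr rfl fun v hv => ?_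
    rw [if_pos ((hE v x (Finset.mem_filter.1 hv).2).2 hx)]
  · rw [Finset.sum_eq_zero]
    · exact dvd_zero _
    · intro v hv
      rw [if_neg fun hv' => hx ((hE v x (Quotient.exact (Finset.mem_filter.1 hv).2)).1 hv')]

theorem isTanabe_comp {r : ℕ} {d₁ d₂ : Diagram n} (h₁ : IsTanabe r d₁) (h₂ : IsTanabe r d₂) :
    IsTanabe r (comp d₁ d₂) := by
  rw [isTanabe_iff]
  rintro C ⟨x, rfl⟩
  let Q : Set (ThreeCol n) := {y | stack d₁ d₂ y (leftRight x)}
  have hQ : ∀ y z, stack d₁ d₂ y z → (y ∈ Q ↔ z ∈ Q) := fun y z h =>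
    ⟨fun hy => Setoid.trans' _ (Setoid.symm' _ h) hy, fun hz => Setoid.trans' _ h hz⟩
  have e₁ := h₁.dvd_of_saturated (E := leftMid ⁻¹' Q) fun y z h => hQ _ _ (stack_left h)
  have e₂ := h₂.dvd_of_saturated (E := midRight ⁻¹' Q) fun y z h => hQ _ _ (stack_right h)
  have e := dvd_add e₁ e₂
  have hm : rightCard (leftMid ⁻¹' Q) = leftCard (midRight ⁻¹' Q) := rfl
  rw [hm, sub_add_sub_cancel] at e
  exact e

theorem isTanabe_permDiagram (r : ℕ) (σ : Equiv.Perm (Fin n)) : IsTanabe r (permDiagram σ) := by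
  rw [isTanabe_iff]
  rintro C ⟨x, rfl⟩
  have h : ∃ j, {y | permDiagram σ y x} = {y | Sum.elim σ id y = j} := ⟨Sum.elim σ id x, rfl⟩
  obtain ⟨j, h⟩ := h
  have hl : leftCard {y | permDiagram σ y x} = 1 := by
    rw [h]
    refine Set.ncard_eq_one.2 ⟨σ.symm j, ?_⟩
    ext i
    exact (Equiv.eq_symm_apply σ).symm
  have hr : rightCard {y | permDiagram σ y x} = 1 := by
    rw [h]
    exact Set.ncard_eq_one.2 ⟨j, rfl⟩
  rw [hl, hr, sub_self]
  exact dvd_zero _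

theorem isTotallyPropagating_iff {d : Diagram n} : IsTotallyPropagating d ↔
    (∀ i, ∃ j, d (Sum.inl i) (Sum.inr j)) ∧ ∀ j, ∃ i, d (Sum.inl i) (Sum.inr j) := by
  constructor
  · intro h
    constructor
    · intro i
      obtain ⟨j, hj⟩ := (h _ (d.mem_classes (Sum.inl i))).2
      exact ⟨j, d.symm' hj⟩
    · intro j
      exact (h _ (d.mem_classes (Sum.inr j))).1
  · rintro ⟨h1, h2⟩ C ⟨x, rfl⟩
    rcases x with i | j
    · obtain ⟨j, hj⟩ := h1 i
      exact ⟨⟨i, d.refl' _⟩, ⟨j, d.symm' hj⟩⟩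
    · obtain ⟨i, hi⟩ := h2 j
      exact ⟨⟨i, hi⟩, ⟨j, d.refl' _⟩⟩

theorem isTotallyPropagating_comp {d₁ d₂ : Diagram n} (h₁ : IsTotallyPropagating d₁)
    (h₂ : IsTotallyPropagating d₂) : IsTotallyPropagating (comp d₁ d₂) := by
  rw [isTotallyPropagating_iff] at *
  constructor
  · intro i
    obtain ⟨m, hm⟩ := h₁.1 i
    obtain ⟨j, hj⟩ := h₂.1 m
    exact ⟨j, Setoid.trans' (stack d₁ d₂) (stack_left hm) (stack_right hj)⟩
  · intro j
    obtain ⟨m, hm⟩ := h₂.2 j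
    obtain ⟨i, hi⟩ := h₁.2 m
    exact ⟨i, Setoid.trans' (stack d₁ d₂) (stack_left hi) (stack_right hm)⟩

theorem isTotallyPropagating_permDiagram (σ : Equiv.Perm (Fin n)) :
    IsTotallyPropagating (permDiagram σ) :=
  isTotallyPropagating_iff.2 ⟨fun i => ⟨σ i, rfl⟩, fun j => ⟨σ.symm j, σ.apply_symm_apply j⟩⟩

theorem isUniform_comp {d₁ d₂ : Diagram n} (h₁ : IsUniform d₁) (h₂ : IsUniform d₂) :
    IsUniform (comp d₁ d₂) :=
  isUniform_iff.2 (isTanabe_comp (isUniform_iff.1 h₁) (isUniform_iff.1 h₂))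

theorem isUniform_permDiagram (σ : Equiv.Perm (Fin n)) : IsUniform (permDiagram σ) :=
  isUniform_iff.2 (isTanabe_permDiagram 0 σ)

/-! ### Permutation diagrams and the augmentation -/

theorem exists_leftRep (d : Diagram n) :
    ∃ f : {C // C ∈ d.classes ∧ IsPropagating C} → Fin n,
      Function.Injective f ∧ ∀ C, Sum.inl (f C) ∈ C.1 := by
  choose f hf using fun C : {C // C ∈ d.classes ∧ IsPropagating C} => C.2.2.1
  exact ⟨f, fun C D h => Subtype.ext (Setoid.eq_of_mem_classes C.2.1 (hf C) D.2.1 (h ▸ hf D)), hf⟩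

theorem exists_rightRep (d : Diagram n) :
    ∃ f : {C // C ∈ d.classes ∧ IsPropagating C} → Fin n,
      Function.Injective f ∧ ∀ C, Sum.inr (f C) ∈ C.1 := by
  choose f hf using fun C : {C // C ∈ d.classes ∧ IsPropagating C} => C.2.2.2
  exact ⟨f, fun C D h => Subtype.ext (Setoid.eq_of_mem_classes C.2.1 (hf C) D.2.1 (h ▸ hf D)), hf⟩

theorem propCount_eq_card (d : Diagram n) :
    propCount d = Nat.card {C // C ∈ d.classes ∧ IsPropagating C} := rfl

theorem propCount_le (d : Diagram n) : propCount d ≤ n := by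
  obtain ⟨f, hf, _⟩ := exists_leftRep d
  rw [propCount_eq_card]
  simpa using Nat.card_le_card_of_injective f hf

theorem isPermutation_iff {d : Diagram n} : IsPermutation d ↔ ∃ σ, d = permDiagram σ := by
  constructor
  · intro h
    obtain ⟨l, hl, hl'⟩ := exists_leftRep d
    obtain ⟨r, hr, hr'⟩ := exists_rightRep d
    have hcard : Nat.card {C // C ∈ d.classes ∧ IsPropagating C} = Nat.card (Fin n) := by
      rw [← propCount_eq_card, h, Nat.card_fin]
    let el := Equiv.ofBijective l ((Nat.bijective_iff_injective_and_card l).2 ⟨hl, hcard⟩)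
    let er := Equiv.ofBijective r ((Nat.bijective_iff_injective_and_card r).2 ⟨hr, hcard⟩)
    have hmr : ∀ j, Sum.inr j ∈ (er.symm j).1 := fun j => by
      have := hr' (er.symm j)
      rwa [show r (er.symm j) = j from er.apply_symm_apply j] at this
    have hml : ∀ i, Sum.inl i ∈ (el.symm i).1 := fun i => by
      have := hl' (el.symm i)
      rwa [show l (el.symm i) = i from el.apply_symm_apply i] at this
    let σ : Equiv.Perm (Fin n) := el.symm.trans er
    have hrel : ∀ x, d x (Sum.inr (Sum.elim σ id x)) := by
      rintro (i | j)
      · refine (mem_class_iff (el.symm i).2.1 ?_).1 (hml i)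
        have := hmr (σ i)
        rwa [show er.symm (σ i) = el.symm i from er.symm_apply_apply _] at this
      · exact d.refl' _
    have hinj : ∀ a b, d (Sum.inr a) (Sum.inr b) → a = b := by
      intro a b hab
      apply er.symm.injective
      refine Subtype.ext (Setoid.eq_of_mem_classes (er.symm a).2.1 (hmr a) (er.symm b).2.1 ?_)
      exact (mem_class_iff (er.symm b).2.1 (hmr b)).2 hab
    refine ⟨σ, le_antisymm ?_ ?_⟩
    · intro x y hxy
      exact hinj _ _ (d.trans' (d.symm' (hrel x)) (d.trans' hxy (hrel y)))
    · intro x y hxy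
      have hxy' : Sum.elim σ id x = Sum.elim σ id y := hxy
      exact d.trans' (hrel x) (hxy' ▸ d.symm' (hrel y))
  · rintro ⟨σ, rfl⟩
    apply le_antisymm (propCount_le _)
    rw [propCount_eq_card]
    have h := Nat.card_le_card_of_injective
      (fun j : Fin n => (⟨{x | permDiagram σ x (Sum.inr j)}, Setoid.mem_classes _ _,
        isTotallyPropagating_permDiagram σ _ (Setoid.mem_classes _ _)⟩ :
        {C // C ∈ (permDiagram σ).classes ∧ IsPropagating C})) ?_
    · simpa using h
    · intro a b hab
      have h1 : (Sum.inr a : Fin n ⊕ Fin n) ∈ {x | permDiagram σ x (Sum.inr b)} := by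
        have e : {x | permDiagram σ x (Sum.inr a)} = {x | permDiagram σ x (Sum.inr b)} :=
          Subtype.ext_iff.1 hab
        rw [← e]
        exact Setoid.refl' (permDiagram σ) _
      exact h1

theorem propCount_comp_le_left (d₁ d₂ : Diagram n) : propCount (comp d₁ d₂) ≤ propCount d₁ := by
  obtain ⟨f, hf, hf'⟩ := exists_leftRep (comp d₁ d₂)
  have hprop : ∀ C, IsPropagating {x | d₁ x (Sum.inl (f C))} := by
    intro C
    refine ⟨⟨f C, d₁.refl' _⟩, ?_⟩
    by_contra hno
    let K : Set (ThreeCol n) := {y | ∃ i, y = Sum.inl i ∧ d₁ (Sum.inl i) (Sum.inl (f C))}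
    have hK : stack d₁ d₂ ≤ Setoid.ker (· ∈ K) := by
      refine stack_le ?_ ?_
      · intro x y hxy
        have key : ∀ x y, d₁ x y → leftMid x ∈ K → leftMid y ∈ K := by
          rintro (x | x) (y | y) hxy ⟨i, hi, hi'⟩
          · cases hi
            exact ⟨y, rfl, d₁.trans' (d₁.symm' hxy) hi'⟩
          · cases hi
            exact absurd ⟨y, d₁.trans' (d₁.symm' hxy) hi'⟩ hno
          · cases hi
          · cases hi
        exact propext ⟨key x y hxy, key y x (d₁.symm' hxy)⟩
      · intro x y _
        have key : ∀ x, midRight x ∉ K := by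
          rintro (x | x) ⟨i, hi, _⟩ <;> cases hi
        exact propext ⟨fun h => absurd h (key x), fun h => absurd h (key y)⟩
    obtain ⟨j, hj⟩ := C.2.2.2
    have hrel : stack d₁ d₂ (leftRight (Sum.inr j)) (leftRight (Sum.inl (f C))) :=
      (mem_class_iff C.2.1 (hf' C)).1 hj
    have h2 : leftRight (Sum.inr j) ∈ K := (iff_of_eq (hK hrel)).2 ⟨f C, rfl, d₁.refl' _⟩
    obtain ⟨i, hi, _⟩ := h2
    cases hi
  rw [propCount_eq_card, propCount_eq_card]
  refine Nat.card_le_card_of_injective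
    (fun C => ⟨{x | d₁ x (Sum.inl (f C))}, d₁.mem_classes _, hprop C⟩) ?_
  intro C D hCD
  have h1 : (Sum.inl (f C) : Fin n ⊕ Fin n) ∈ {x | d₁ x (Sum.inl (f D))} := by
    have e : {x | d₁ x (Sum.inl (f C))} = {x | d₁ x (Sum.inl (f D))} := Subtype.ext_iff.1 hCD
    rw [← e]
    exact d₁.refl' _
  refine Subtype.ext (Setoid.eq_of_mem_classes C.2.1 (hf' C) D.2.1 ?_)
  exact (mem_class_iff D.2.1 (hf' D)).2 (stack_left h1)

theorem propCount_comp_le_right (d₁ d₂ : Diagram n) : propCount (comp d₁ d₂) ≤ propCount d₂ := by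
  obtain ⟨f, hf, hf'⟩ := exists_rightRep (comp d₁ d₂)
  have hprop : ∀ C, IsPropagating {x | d₂ x (Sum.inr (f C))} := by
    intro C
    refine ⟨?_, ⟨f C, d₂.refl' _⟩⟩
    by_contra hno
    let K : Set (ThreeCol n) :=
      {y | ∃ i, y = Sum.inr (Sum.inr i) ∧ d₂ (Sum.inr i) (Sum.inr (f C))}
    have hK : stack d₁ d₂ ≤ Setoid.ker (· ∈ K) := by
      refine stack_le ?_ ?_
      · intro x y _
        have key : ∀ x, leftMid x ∉ K := by
          rintro (x | x) ⟨i, hi, _⟩ <;> cases hi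
        exact propext ⟨fun h => absurd h (key x), fun h => absurd h (key y)⟩
      · intro x y hxy
        have key : ∀ x y, d₂ x y → midRight x ∈ K → midRight y ∈ K := by
          rintro (x | x) (y | y) hxy ⟨i, hi, hi'⟩
          · cases hi
          · cases hi
          · cases hi
            exact absurd ⟨y, d₂.trans' (d₂.symm' hxy) hi'⟩ hno
          · cases hi
            exact ⟨y, rfl, d₂.trans' (d₂.symm' hxy) hi'⟩
        exact propext ⟨key x y hxy, key y x (d₂.symm' hxy)⟩
    obtain ⟨j, hj⟩ := C.2.2.1
    have hrel : stack d₁ d₂ (leftRight (Sum.inl j)) (leftRight (Sum.inr (f C))) :=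
      (mem_class_iff C.2.1 (hf' C)).1 hj
    have h2 : leftRight (Sum.inl j) ∈ K := (iff_of_eq (hK hrel)).2 ⟨f C, rfl, d₂.refl' _⟩
    obtain ⟨i, hi, _⟩ := h2
    cases hi
  rw [propCount_eq_card, propCount_eq_card]
  refine Nat.card_le_card_of_injective
    (fun C => ⟨{x | d₂ x (Sum.inr (f C))}, d₂.mem_classes _, hprop C⟩) ?_
  intro C D hCD
  have h1 : (Sum.inr (f C) : Fin n ⊕ Fin n) ∈ {x | d₂ x (Sum.inr (f D))} := by
    have e : {x | d₂ x (Sum.inr (f C))} = {x | d₂ x (Sum.inr (f D))} := Subtype.ext_iff.1 hCD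
    rw [← e]
    exact d₂.refl' _
  refine Subtype.ext (Setoid.eq_of_mem_classes C.2.1 (hf' C) D.2.1 ?_)
  exact (mem_class_iff D.2.1 (hf' D)).2 (stack_right h1)

theorem isPermutation_permDiagram (σ : Equiv.Perm (Fin n)) : IsPermutation (permDiagram σ) :=
  isPermutation_iff.2 ⟨σ, rfl⟩

theorem isPermutation_comp_iff {d₁ d₂ : Diagram n} :
    IsPermutation (comp d₁ d₂) ↔ IsPermutation d₁ ∧ IsPermutation d₂ := by
  constructor
  · intro h
    have h' : propCount (comp d₁ d₂) = n := h
    exact ⟨le_antisymm (propCount_le _) (h'.symm.trans_le (propCount_comp_le_left d₁ d₂)),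
      le_antisymm (propCount_le _) (h'.symm.trans_le (propCount_comp_le_right d₁ d₂))⟩
  · rintro ⟨h₁, h₂⟩
    obtain ⟨σ, rfl⟩ := isPermutation_iff.1 h₁
    obtain ⟨τ, rfl⟩ := isPermutation_iff.1 h₂
    refine isPermutation_iff.2 ⟨σ.trans τ, le_antisymm ?_ ?_⟩
    · have h : stack (permDiagram σ) (permDiagram τ) ≤
          Setoid.ker (Sum.elim (σ.trans τ) (Sum.elim τ id) : ThreeCol n → Fin n) := by
        refine stack_le ?_ ?_
        · rintro (i | i) (j | j) h <;> exact congrArg τ h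
        · rintro (i | i) (j | j) h <;> exact h
      rintro (i | i) (j | j) hxy <;> exact h hxy
    · have hrel : ∀ x, stack (permDiagram σ) (permDiagram τ) (leftRight x)
          (leftRight (Sum.inr (Sum.elim (σ.trans τ) id x))) := by
        rintro (i | i)
        · exact Setoid.trans' _ (stack_left (permDiagram_rel σ i))
            (stack_right (permDiagram_rel τ (σ i)))
        · exact Setoid.refl' _ _
      intro x y hxy
      have hxy' : Sum.elim (σ.trans τ) id x = Sum.elim (σ.trans τ) id y := hxy
      exact Setoid.trans' _ (hrel x) (hxy' ▸ Setoid.symm' _ (hrel y))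

end Closure

/-! ### The partition algebra -/

/-- The underlying module of the partition algebra `P_n(δ)`: the free `k`-module on the partition
`n`-diagrams. -/
@[nolint unusedArguments]
def PartitionAlgebra (k : Type u) [CommRing k] (_δ : k) (n : ℕ) : Type u := Diagram n →₀ k

namespace PartitionAlgebra

variable {k : Type u} [CommRing k] {δ : k} {n : ℕ}

noncomputable instance : AddCommGroup (PartitionAlgebra k δ n) :=
  inferInstanceAs (AddCommGroup (Diagram n →₀ k))

noncomputable instance : Module k (PartitionAlgebra k δ n) :=
  inferInstanceAs (Module k (Diagram n →₀ k))

/-- The basis of diagrams. -/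
noncomputable def basis (k : Type u) [CommRing k] (δ : k) (n : ℕ) :
    Module.Basis (Diagram n) k (PartitionAlgebra k δ n) :=
  Module.Basis.ofRepr (LinearEquiv.refl k (Diagram n →₀ k))

/-- The bilinear extension of `(d₁, d₂) ↦ δ ^ α • d₃`. -/
noncomputable def mulHom (k : Type u) [CommRing k] (δ : k) (n : ℕ) :
    PartitionAlgebra k δ n →ₗ[k] PartitionAlgebra k δ n →ₗ[k] PartitionAlgebra k δ n :=
  (basis k δ n).constr k fun d₁ => (basis k δ n).constr k fun d₂ =>
    δ ^ midCount d₁ d₂ • basis k δ n (comp d₁ d₂)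

theorem mulHom_basis (d₁ d₂ : Diagram n) :
    mulHom k δ n (basis k δ n d₁) (basis k δ n d₂) =
      δ ^ midCount d₁ d₂ • basis k δ n (comp d₁ d₂) := by
  simp [mulHom, Module.Basis.constr_basis]

theorem mulHom_assoc (x y z : PartitionAlgebra k δ n) :
    mulHom k δ n (mulHom k δ n x y) z = mulHom k δ n x (mulHom k δ n y z) := by
  have h : (LinearMap.compr₂ (mulHom k δ n) (mulHom k δ n)) =
      (LinearMap.llcomp k _ _ _).flip (mulHom k δ n) ∘ₗ
        (LinearMap.llcomp k _ _ _ ∘ₗ mulHom k δ n) := by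
    refine (basis k δ n).ext fun d₁ => (basis k δ n).ext fun d₂ => (basis k δ n).ext fun d₃ => ?_
    simp only [LinearMap.compr₂_apply, mulHom_basis, map_smul, LinearMap.smul_apply,
      LinearMap.coe_comp, Function.comp_apply, LinearMap.flip_apply, LinearMap.llcomp_apply,
      smul_smul, ← pow_add, comp_assoc, midCount_assoc]
  exact LinearMap.congr_fun (LinearMap.congr_fun (LinearMap.congr_fun h x) y) z

theorem mulHom_one_left (x : PartitionAlgebra k δ n) :
    mulHom k δ n (basis k δ n (idDiagram n)) x = x := by
  have h : mulHom k δ n (basis k δ n (idDiagram n)) = LinearMap.id := by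
    refine (basis k δ n).ext fun d => ?_
    rw [mulHom_basis, id_comp, idDiagram, midCount_perm_left, pow_zero, one_smul]
    rfl
  rw [h]
  rfl

theorem mulHom_one_right (x : PartitionAlgebra k δ n) :
    mulHom k δ n x (basis k δ n (idDiagram n)) = x := by
  have h : (mulHom k δ n).flip (basis k δ n (idDiagram n)) = LinearMap.id := by
    refine (basis k δ n).ext fun d => ?_
    rw [LinearMap.flip_apply, mulHom_basis, comp_id, idDiagram, midCount_perm_right, pow_zero,
      one_smul]
    rfl
  exact LinearMap.congr_fun h x

noncomputable instance : Ring (PartitionAlgebra k δ n) :=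
  { (inferInstance : AddCommGroup (PartitionAlgebra k δ n)) with
    mul := fun x y => mulHom k δ n x y
    one := basis k δ n (idDiagram n)
    mul_assoc := mulHom_assoc
    one_mul := mulHom_one_left
    mul_one := mulHom_one_right
    left_distrib := fun x y z => map_add (mulHom k δ n x) y z
    right_distrib := fun x y z => LinearMap.map_add₂ (mulHom k δ n) x y z
    zero_mul := fun x => LinearMap.map_zero₂ (mulHom k δ n) x
    mul_zero := fun x => map_zero (mulHom k δ n x) }

noncomputable instance : Algebra k (PartitionAlgebra k δ n) :=
  Algebra.ofModule (fun r x y => LinearMap.map_smul₂ (mulHom k δ n) r x y)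
    (fun r x y => map_smul (mulHom k δ n x) r y)

theorem mul_def (x y : PartitionAlgebra k δ n) : x * y = mulHom k δ n x y := rfl

theorem one_def : (1 : PartitionAlgebra k δ n) = basis k δ n (idDiagram n) := rfl

theorem basis_mul (d₁ d₂ : Diagram n) :
    basis k δ n d₁ * basis k δ n d₂ = δ ^ midCount d₁ d₂ • basis k δ n (comp d₁ d₂) :=
  mulHom_basis d₁ d₂

/-- The subalgebra spanned `k`-linearly by a set of diagrams that contains the identity diagram
and is closed under composition. -/
noncomputable def spanSubalgebra (k : Type u) [CommRing k] (δ : k) (n : ℕ) (p : Diagram n → Prop)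
    (hone : p (idDiagram n)) (hmul : ∀ d₁ d₂, p d₁ → p d₂ → p (comp d₁ d₂)) :
    Subalgebra k (PartitionAlgebra k δ n) :=
  (Submodule.span k (basis k δ n '' {d | p d})).toSubalgebra
    (Submodule.subset_span ⟨_, hone, rfl⟩) (by
      intro x y hx hy
      induction hx using Submodule.span_induction with
      | zero => rw [zero_mul]; exact Submodule.zero_mem _
      | add a b _ _ ha hb => rw [add_mul]; exact Submodule.add_mem _ ha hb
      | smul r a _ ha => rw [smul_mul_assoc]; exact Submodule.smul_mem _ _ ha
      | mem a ha =>
        obtain ⟨d₁, h₁, rfl⟩ := ha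
        induction hy using Submodule.span_induction with
        | zero => rw [mul_zero]; exact Submodule.zero_mem _
        | add a b _ _ ha hb => rw [mul_add]; exact Submodule.add_mem _ ha hb
        | smul r a _ ha => rw [mul_smul_comm]; exact Submodule.smul_mem _ _ ha
        | mem a ha =>
          obtain ⟨d₂, h₂, rfl⟩ := ha
          rw [basis_mul]
          exact Submodule.smul_mem _ _ (Submodule.subset_span ⟨_, hmul d₁ d₂ h₁ h₂, rfl⟩))

open Classical in
/-- The augmentation of the partition algebra, sending permutation diagrams to `1` and all other
diagrams to `0`. -/
noncomputable def augmentation (k : Type u) [CommRing k] (δ : k) (n : ℕ) :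
    PartitionAlgebra k δ n →ₐ[k] k :=
  AlgHom.ofLinearMap
    ((basis k δ n).constr k fun d => if IsPermutation d then (1 : k) else 0)
    (by
      rw [one_def, Module.Basis.constr_basis]
      exact if_pos (isPermutation_permDiagram 1))
    (by
      set ε := (basis k δ n).constr k fun d => if IsPermutation d then (1 : k) else 0 with hε
      have h : (mulHom k δ n).compr₂ ε = (LinearMap.mul k k).compl₁₂ ε ε := by
        refine (basis k δ n).ext fun d₁ => (basis k δ n).ext fun d₂ => ?_
        simp only [LinearMap.compr₂_apply, mulHom_basis, map_smul, LinearMap.compl₁₂_apply,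
          LinearMap.mul_apply', hε, Module.Basis.constr_basis, isPermutation_comp_iff, smul_eq_mul]
        by_cases h₁ : IsPermutation d₁
        · by_cases h₂ : IsPermutation d₂
          · obtain ⟨σ, rfl⟩ := isPermutation_iff.1 h₁
            rw [midCount_perm_left]
            simp [h₁, h₂]
          · simp [h₂]
        · simp [h₁]
      exact fun x y => LinearMap.congr_fun (LinearMap.congr_fun h x) y)

/-- The augmentation restricted to a subalgebra. -/
noncomputable def subAugmentation (A : Subalgebra k (PartitionAlgebra k δ n)) : A →ₐ[k] k :=
  (augmentation k δ n).comp A.val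

end PartitionAlgebra

/-- The Tanabe algebra `T_n(δ, r)`. -/
noncomputable def tanabeAlgebra (k : Type u) [CommRing k] (δ : k) (n r : ℕ) :
    Subalgebra k (PartitionAlgebra k δ n) :=
  PartitionAlgebra.spanSubalgebra k δ n (IsTanabe r) (isTanabe_permDiagram r 1)
    (fun _ _ => isTanabe_comp)

/-- The totally propagating partition algebra `TPP_n`, as a subalgebra of `P_n(δ)`. -/
noncomputable def tppAlgebra (k : Type u) [CommRing k] (δ : k) (n : ℕ) :
    Subalgebra k (PartitionAlgebra k δ n) :=
  PartitionAlgebra.spanSubalgebra k δ n IsTotallyPropagating (isTotallyPropagating_permDiagram 1)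
    (fun _ _ => isTotallyPropagating_comp)

/-- The uniform block permutation algebra `U_n`, as a subalgebra of `P_n(δ)`. -/
noncomputable def uniformBlockAlgebra (k : Type u) [CommRing k] (δ : k) (n : ℕ) :
    Subalgebra k (PartitionAlgebra k δ n) :=
  PartitionAlgebra.spanSubalgebra k δ n IsUniform (isUniform_permDiagram 1)
    (fun _ _ => isUniform_comp)

/-! ### Tor and Ext over a (noncommutative) `k`-algebra -/

open CategoryTheory TensorProduct MulOpposite

section TorExt

variable (k : Type u) [CommRing k] (A : Type u) [Ring A] [Algebra k A]

open ModuleCat.Algebra in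
/-- The submodule of `X ⊗_k M` spanned by the elements `x a ⊗ m - x ⊗ a m`. -/
def balancedRelations (X : ModuleCat.{u} Aᵐᵒᵖ) (M : ModuleCat.{u} A) : Submodule k (X ⊗[k] M) :=
  Submodule.span k
    {t | ∃ (x : X) (a : A) (m : M), t = (op a • x) ⊗ₜ[k] m - x ⊗ₜ[k] (a • m)}

open ModuleCat.Algebra in
/-- The map `X ⊗_A M → X ⊗_A N` induced by `f : M → N`. -/
noncomputable def tensorMap (X : ModuleCat.{u} Aᵐᵒᵖ) {M N : ModuleCat.{u} A} (f : M →ₗ[A] N) :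
    ((X ⊗[k] M) ⧸ balancedRelations k A X M) →ₗ[k] ((X ⊗[k] N) ⧸ balancedRelations k A X N) :=
  (balancedRelations k A X M).mapQ (balancedRelations k A X N)
    ((f.restrictScalars k).lTensor X) (by
      refine Submodule.span_le.2 ?_
      rintro _ ⟨x, a, m, rfl⟩
      refine Submodule.subset_span ⟨x, a, f m, ?_⟩
      simp)

open ModuleCat.Algebra in
/-- The functor `X ⊗_A -` from left `A`-modules to `k`-modules, for a right `A`-module `X`
(a left `Aᵐᵒᵖ`-module): the quotient of `X ⊗_k M` by the relations `x a ⊗ m = x ⊗ a m`. -/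
noncomputable def tensorFunctor (X : ModuleCat.{u} Aᵐᵒᵖ) : ModuleCat.{u} A ⥤ ModuleCat.{u} k where
  obj M := ModuleCat.of k ((X ⊗[k] M) ⧸ balancedRelations k A X M)
  map f := ModuleCat.ofHom (tensorMap k A X f.hom)
  map_id M := by
    refine ModuleCat.hom_ext (Submodule.linearMap_qext _ (TensorProduct.ext' fun x m => ?_))
    rfl
  map_comp f g := by
    refine ModuleCat.hom_ext (Submodule.linearMap_qext _ (TensorProduct.ext' fun x m => ?_))
    rfl

open ModuleCat.Algebra in
instance (X : ModuleCat.{u} Aᵐᵒᵖ) : (tensorFunctor k A X).Additive where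
  map_add {M N f g} := by
    refine ModuleCat.hom_ext (Submodule.linearMap_qext _ (TensorProduct.ext' fun x m => ?_))
    exact congrArg (Submodule.Quotient.mk (p := balancedRelations k A X N))
      (TensorProduct.tmul_add x (f.hom m) (g.hom m))

/-- `Tor_i^A(X, M)`, as a `k`-module: the `i`-th left derived functor of `X ⊗_A -` at `M`. -/
noncomputable def torModule (X : ModuleCat.{u} Aᵐᵒᵖ) (M : ModuleCat.{u} A) (i : ℕ) :
    ModuleCat.{u} k :=
  ((tensorFunctor k A X).leftDerived i).obj M

open ModuleCat.Algebra in
/-- `Ext^i_A(X, Y)` for left `A`-modules, as a `k`-module. -/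
noncomputable def extModule (X Y : ModuleCat.{u} A) (i : ℕ) : ModuleCat.{u} k :=
  ((Ext k (ModuleCat.{u} A) i).obj (Opposite.op X)).obj Y

variable {k A}

/-- The trivial left module of an augmented algebra: `k` with `A` acting through `ε`. -/
noncomputable def trivialLeft (ε : A →ₐ[k] k) : ModuleCat.{u} A :=
  (ModuleCat.restrictScalars ε.toRingHom).obj (ModuleCat.of k k)

/-- The trivial right module of an augmented algebra: `k` with `A` acting through `ε`. -/
noncomputable def trivialRight (ε : A →ₐ[k] k) : ModuleCat.{u} Aᵐᵒᵖ :=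
  (ModuleCat.restrictScalars (ε.toRingHom.fromOpposite fun _ _ => Commute.all _ _)).obj
    (ModuleCat.of k k)

/-- The homology `Tor_i^A(𝟙, 𝟙)` of an augmented algebra. -/
noncomputable def augHomology (ε : A →ₐ[k] k) (i : ℕ) : ModuleCat.{u} k :=
  torModule k A (trivialRight ε) (trivialLeft ε) i

/-- The cohomology `Ext^i_A(𝟙, 𝟙)` of an augmented algebra, computed with right modules. -/
noncomputable def augCohomology (ε : A →ₐ[k] k) (i : ℕ) : ModuleCat.{u} k :=
  extModule k Aᵐᵒᵖ (trivialRight ε) (trivialRight ε) i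

end TorExt

/-! ### (Co)homology of the symmetric groups -/

/-- `H_i(Σ_n, 𝟙)`, with `Σ_n` the group of permutations of `Fin n` (lifted to the universe of
`k`) and `𝟙 = k` with trivial action. -/
noncomputable def symmHomology (k : Type u) [CommRing k] (n i : ℕ) : ModuleCat.{u} k :=
  groupHomology (Rep.trivial k (ULift.{u} (Equiv.Perm (Fin n))) k) i

/-- `H^i(Σ_n, 𝟙)`. -/
noncomputable def symmCohomology (k : Type u) [CommRing k] (n i : ℕ) : ModuleCat.{u} k :=
  groupCohomology (Rep.trivial k (ULift.{u} (Equiv.Perm (Fin n))) k) i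

end TanabeCohomology

/-!
Let `A` be one of the three algebras and `I ⊆ A` the span of its non-permutation diagrams, so that
`A / I` is the group algebra `k[Σ_n]`.  The point is that `A / I` is projective as an `A`-module,
on either side.

For a partition `s` of `{1, …, n}` let `e_s` (`mergeDiagram`) be the diagram with the blocks
`C ∪ \bar C`, where `C` runs through the blocks of `s`.  These diagrams are uniform, hence lie in all
three algebras; `e_s e_t = e_{s ∨ t}`, so they commute; and `d e_s = d` if `s` is the partition
induced by `d` on its right column.  If `d ∈ A` is not a permutation diagram, then two of its right
vertices are connected (`IsTanabe.isPermutation_of_right`,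
`IsTotallyPropagating.isPermutation_of_right`): otherwise some right vertex would be isolated, which
is excluded in a totally propagating diagram and, as `r ∤ 1`, in a Tanabe diagram; uniform diagrams
are the case `r = 0`.  So the product
`f = ∏ (1 - e_s)` over all `s` with a block of more than one element (`permIdempotent`) satisfies
`I f = 0`, while `f ≡ 1` modulo `I`.  Hence `a ↦ a f` induces an `A`-linear section of `A → A / I`,
and `A / I` is a projective left module (`projective_of_ker_mul_eq_zero`).  The same argument with
left and right exchanged gives `f I = 0` and the projectivity of the right module `A / I`.

Consequently a projective resolution of `𝟙` over `k[Σ_n]` is also one over `A`.  As `A → k[Σ_n]` is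
surjective, tensoring it with `𝟙` over `A` is taking coinvariants, and `A`-linear maps out of it are
maps of representations (`nonempty_torModule_iso`, `nonempty_extModule_iso`).

Composition of diagrams is the opposite of composition of permutations.  Therefore `σ ↦ σ⁻¹` is used
to identify `A / I` with `k[Σ_n]` for left modules, and no inversion is needed for right modules.
-/

namespace TanabeCohomology

open MulOpposite

/-! ### Diagrams of partitions of one column -/

section Diagrams

variable {n : ℕ}

theorem comp_permDiagram (σ τ : Equiv.Perm (Fin n)) :
    comp (permDiagram σ) (permDiagram τ) = permDiagram (σ.trans τ) := by
  refine le_antisymm ?_ ?_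
  · have h : stack (permDiagram σ) (permDiagram τ) ≤
        Setoid.ker (Sum.elim (σ.trans τ) (Sum.elim τ id) : ThreeCol n → Fin n) := by
      refine stack_le ?_ ?_
      · rintro (i | i) (j | j) h <;> exact congrArg τ h
      · rintro (i | i) (j | j) h <;> exact h
    rintro (i | i) (j | j) hxy <;> exact h hxy
  · have hrel : ∀ x, stack (permDiagram σ) (permDiagram τ) (leftRight x)
        (leftRight (Sum.inr (Sum.elim (σ.trans τ) id x))) := by
      rintro (i | i)
      · exact Setoid.trans' _ (stack_left (permDiagram_rel σ i))
          (stack_right (permDiagram_rel τ (σ i)))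
      · exact Setoid.refl' _ _
    intro x y hxy
    have hxy' : Sum.elim (σ.trans τ) id x = Sum.elim (σ.trans τ) id y := hxy
    exact Setoid.trans' _ (hrel x) (hxy' ▸ Setoid.symm' _ (hrel y))

theorem permDiagram_injective : Function.Injective (permDiagram (n := n)) := by
  intro σ τ h
  ext i
  have h1 : permDiagram τ (Sum.inl i) (Sum.inr (σ i)) := h ▸ permDiagram_rel σ i
  exact congrArg Fin.val (h1 : τ i = σ i).symm

/-- The diagram of a partition `s` of `{1, …, n}`: its blocks are `C ∪ \bar C` for the blocks `C`
of `s`. -/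
@[reducible] def mergeDiagram (s : Setoid (Fin n)) : Diagram n := s.comap (Sum.elim id id)

theorem midCount_mergeDiagram_right (d : Diagram n) (s : Setoid (Fin n)) :
    midCount d (mergeDiagram s) = 0 :=
  midCount_eq_zero_of fun j => ⟨Sum.inr j, Setoid.symm' _
    (stack_right (d₁ := d) (d₂ := mergeDiagram s) (x := Sum.inl j) (y := Sum.inr j) (s.refl' j))⟩

theorem midCount_mergeDiagram_left (d : Diagram n) (s : Setoid (Fin n)) :
    midCount (mergeDiagram s) d = 0 :=
  midCount_eq_zero_of fun j => ⟨Sum.inl j,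
    stack_left (d₁ := mergeDiagram s) (d₂ := d) (x := Sum.inl j) (y := Sum.inr j) (s.refl' j)⟩

theorem comp_mergeDiagram_right {d : Diagram n} {s : Setoid (Fin n)}
    (h : s ≤ d.comap Sum.inr) : comp d (mergeDiagram s) = d := by
  have hl : ∀ x : Fin n ⊕ Fin n, stack d (mergeDiagram s) (leftRight x) (leftMid x) := by
    rintro (i | i)
    · exact Setoid.refl' _ _
    · exact stack_right (d₁ := d) (d₂ := mergeDiagram s) (x := Sum.inr i) (y := Sum.inl i)
        (s.refl' i)
  apply le_antisymm
  · have h : stack d (mergeDiagram s) ≤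
        d.comap (Sum.elim Sum.inl (Sum.elim Sum.inr Sum.inr) : ThreeCol n → Fin n ⊕ Fin n) := by
      refine stack_le ?_ ?_
      · rintro (i | i) (j | j) h <;> exact h
      · rintro (i | i) (j | j) hij <;> exact h hij
    rintro (i | i) (j | j) hxy <;> exact h hxy
  · intro x y hxy
    change stack _ _ (leftRight x) (leftRight y)
    exact Setoid.trans' _ (hl x) (Setoid.trans' _ (stack_left hxy) (Setoid.symm' _ (hl y)))

theorem comp_mergeDiagram_left {d : Diagram n} {s : Setoid (Fin n)}
    (h : s ≤ d.comap Sum.inl) : comp (mergeDiagram s) d = d := by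
  have hl : ∀ x : Fin n ⊕ Fin n, stack (mergeDiagram s) d (leftRight x) (midRight x) := by
    rintro (i | i)
    · exact stack_left (d₁ := mergeDiagram s) (d₂ := d) (x := Sum.inl i) (y := Sum.inr i)
        (s.refl' i)
    · exact Setoid.refl' _ _
  apply le_antisymm
  · have h : stack (mergeDiagram s) d ≤
        d.comap (Sum.elim Sum.inl (Sum.elim Sum.inl Sum.inr) : ThreeCol n → Fin n ⊕ Fin n) := by
      refine stack_le ?_ ?_
      · rintro (i | i) (j | j) hij <;> exact h hij
      · rintro (i | i) (j | j) h <;> exact h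
    rintro (i | i) (j | j) hxy <;> exact h hxy
  · intro x y hxy
    change stack _ _ (leftRight x) (leftRight y)
    exact Setoid.trans' _ (hl x) (Setoid.trans' _ (stack_right hxy) (Setoid.symm' _ (hl y)))

theorem comp_mergeDiagram (s t : Setoid (Fin n)) :
    comp (mergeDiagram s) (mergeDiagram t) = mergeDiagram (s ⊔ t) := by
  set T := stack (mergeDiagram s) (mergeDiagram t) with hT
  have hl : ∀ x : Fin n ⊕ Fin n, T (leftRight x) (Sum.inr (Sum.inl (Sum.elim id id x))) := by
    rintro (i | i)
    · exact stack_left (d₁ := mergeDiagram s) (x := Sum.inl i) (y := Sum.inr i) (s.refl' i)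
    · exact stack_right (d₂ := mergeDiagram t) (x := Sum.inr i) (y := Sum.inl i) (t.refl' i)
  apply le_antisymm
  · have h : T ≤ (s ⊔ t).comap (Sum.elim id (Sum.elim id id) : ThreeCol n → Fin n) := by
      refine stack_le ?_ ?_
      · rintro (i | i) (j | j) hij <;> exact (le_sup_left : s ≤ s ⊔ t) hij
      · rintro (i | i) (j | j) hij <;> exact (le_sup_right : t ≤ s ⊔ t) hij
    rintro (i | i) (j | j) hxy <;> exact h hxy
  · have h : s ⊔ t ≤ T.comap (fun j => Sum.inr (Sum.inl j)) :=
      sup_le (fun i j hij => stack_left (d₁ := mergeDiagram s) (x := Sum.inr i) (y := Sum.inr j) hij)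
        (fun i j hij => stack_right (d₂ := mergeDiagram t) (x := Sum.inl i) (y := Sum.inl j) hij)
    intro x y hxy
    change T (leftRight x) (leftRight y)
    exact Setoid.trans' _ (hl x) (Setoid.trans' _ (h hxy) (Setoid.symm' _ (hl y)))

theorem not_isPermutation_mergeDiagram {s : Setoid (Fin n)} (hs : s ≠ ⊥) :
    ¬ IsPermutation (mergeDiagram s) := by
  rw [isPermutation_iff]
  rintro ⟨σ, h⟩
  refine hs (eq_bot_iff.2 fun i j hij => ?_)
  exact (h ▸ (show mergeDiagram s (Sum.inr i) (Sum.inr j) from hij) :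
    permDiagram σ (Sum.inr i) (Sum.inr j))

theorem isUniform_mergeDiagram (s : Setoid (Fin n)) : IsUniform (mergeDiagram s) := by
  rintro C ⟨x, rfl⟩
  rfl

theorem isTanabe_mergeDiagram (r : ℕ) (s : Setoid (Fin n)) : IsTanabe r (mergeDiagram s) := by
  intro C hC
  rw [kappa, isUniform_mergeDiagram s C hC, sub_self]
  rfl

theorem isTotallyPropagating_mergeDiagram (s : Setoid (Fin n)) :
    IsTotallyPropagating (mergeDiagram s) :=
  isTotallyPropagating_iff.2 ⟨fun i => ⟨i, s.refl' i⟩, fun i => ⟨i, s.refl' i⟩⟩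

/-! ### Diagrams without two connected vertices in a column -/

/-- A diagram whose right vertices lie in distinct components, all of them propagating, is a
permutation diagram. -/
theorem isPermutation_of_right {d : Diagram n} (hb : d.comap Sum.inr = ⊥)
    (h : ∀ j, ∃ i, d (Sum.inl i) (Sum.inr j)) : IsPermutation d := by
  refine le_antisymm (propCount_le d) ?_
  rw [propCount_eq_card]
  have h := Nat.card_le_card_of_injective
    (fun j : Fin n => (⟨{x | d x (Sum.inr j)}, d.mem_classes _, h j, j, d.refl' _⟩ :
      {C // C ∈ d.classes ∧ IsPropagating C})) fun a b hab => by
    have e : {x | d x (Sum.inr a)} = {x | d x (Sum.inr b)} := Subtype.ext_iff.1 hab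
    have h2 : d.comap Sum.inr a b := e.subset (d.refl' (Sum.inr a))
    rw [hb] at h2
    exact h2
  simpa using h

/-- A diagram whose left vertices lie in distinct components, all of them propagating, is a
permutation diagram. -/
theorem isPermutation_of_left {d : Diagram n} (hb : d.comap Sum.inl = ⊥)
    (h : ∀ i, ∃ j, d (Sum.inl i) (Sum.inr j)) : IsPermutation d := by
  refine le_antisymm (propCount_le d) ?_
  rw [propCount_eq_card]
  have h := Nat.card_le_card_of_injective
    (fun i : Fin n => (⟨{x | d x (Sum.inl i)}, d.mem_classes _, ⟨i, d.refl' _⟩,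
      (h i).imp fun _ hj => d.symm' hj⟩ :
      {C // C ∈ d.classes ∧ IsPropagating C})) fun a b hab => by
    have e : {x | d x (Sum.inl a)} = {x | d x (Sum.inl b)} := Subtype.ext_iff.1 hab
    have h2 : d.comap Sum.inl a b := e.subset (d.refl' (Sum.inl a))
    rw [hb] at h2
    exact h2
  simpa using h

theorem IsTotallyPropagating.isPermutation_of_right {d : Diagram n} (h : IsTotallyPropagating d)
    (hb : d.comap Sum.inr = ⊥) : IsPermutation d :=
  TanabeCohomology.isPermutation_of_right hb (isTotallyPropagating_iff.1 h).2

theorem IsTotallyPropagating.isPermutation_of_left {d : Diagram n} (h : IsTotallyPropagating d)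
    (hb : d.comap Sum.inl = ⊥) : IsPermutation d :=
  TanabeCohomology.isPermutation_of_left hb (isTotallyPropagating_iff.1 h).1

/-- For `r ≠ 1` an isolated right vertex would be a component with `L(C) - R(C) = -1`, which is
not divisible by `r`. -/
theorem IsTanabe.isPermutation_of_right {r : ℕ} (hr : r ≠ 1) {d : Diagram n} (h : IsTanabe r d)
    (hb : d.comap Sum.inr = ⊥) : IsPermutation d := by
  refine TanabeCohomology.isPermutation_of_right hb fun j => ?_
  by_contra hno
  have hC := isTanabe_iff.1 h _ (d.mem_classes (Sum.inr j))
  have hl : leftCard {x | d x (Sum.inr j)} = 0 := by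
    unfold leftCard
    rw [Set.ncard_eq_zero]
    exact Set.eq_empty_of_forall_notMem fun i hi => hno ⟨i, hi⟩
  have hr' : rightCard {x | d x (Sum.inr j)} = 1 := by
    refine Set.ncard_eq_one.2 ⟨j, Set.ext fun i => ⟨fun hi => ?_, ?_⟩⟩
    · have h2 : d.comap Sum.inr i j := hi
      rw [hb] at h2
      exact h2
    · rintro rfl
      exact d.refl' _
  rw [hl, hr'] at hC
  refine hr (Nat.dvd_one.1 (Int.natCast_dvd_natCast.1 ?_))
  simpa using hC

/-- For `r ≠ 1` an isolated left vertex would be a component with `L(C) - R(C) = 1`, which is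
not divisible by `r`. -/
theorem IsTanabe.isPermutation_of_left {r : ℕ} (hr : r ≠ 1) {d : Diagram n} (h : IsTanabe r d)
    (hb : d.comap Sum.inl = ⊥) : IsPermutation d := by
  refine TanabeCohomology.isPermutation_of_left hb fun j => ?_
  by_contra hno
  have hC := isTanabe_iff.1 h _ (d.mem_classes (Sum.inl j))
  have hl : rightCard {x | d x (Sum.inl j)} = 0 := by
    unfold rightCard
    rw [Set.ncard_eq_zero]
    exact Set.eq_empty_of_forall_notMem fun i hi => hno ⟨i, d.symm' hi⟩
  have hr' : leftCard {x | d x (Sum.inl j)} = 1 := by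
    refine Set.ncard_eq_one.2 ⟨j, Set.ext fun i => ⟨fun hi => ?_, ?_⟩⟩
    · have h2 : d.comap Sum.inl i j := hi
      rw [hb] at h2
      exact h2
    · rintro rfl
      exact d.refl' _
  rw [hl, hr'] at hC
  refine hr (Nat.dvd_one.1 (Int.natCast_dvd_natCast.1 ?_))
  simpa using hC

end Diagrams

namespace PartitionAlgebra

/-! ### Projection to the permutation diagrams -/

variable {k : Type u} [CommRing k] {δ : k} {n : ℕ}

section permLift

variable {R : Type*} [Ring R] [Algebra k R] (φ : (Equiv.Perm (Fin n))ᵐᵒᵖ →* R)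

open Classical in
/-- The function that sends the diagram of a permutation `σ` to `φ σ` and all other diagrams
to `0`.  Composition of diagrams is the opposite of composition of permutations, so that a
multiplicative `φ` is a homomorphism on the opposite group. -/
noncomputable def permValue (d : Diagram n) : R :=
  if h : ∃ σ, d = permDiagram σ then φ (op h.choose) else 0

theorem permValue_permDiagram (σ : Equiv.Perm (Fin n)) : permValue φ (permDiagram σ) = φ (op σ) := by
  have h : ∃ τ, permDiagram σ = permDiagram τ := ⟨σ, rfl⟩
  rw [permValue, dif_pos h, ← permDiagram_injective h.choose_spec]

theorem permValue_eq_zero {d : Diagram n} (hd : ¬ IsPermutation d) : permValue φ d = 0 :=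
  dif_neg fun h => hd (isPermutation_iff.2 h)

/-- The algebra map `P_n(δ) → R` that sends the diagram of a permutation `σ` to `φ σ` and all
other diagrams to `0`.  It is multiplicative because a composite of diagrams is a permutation
diagram only if both factors are. -/
noncomputable def permLift : PartitionAlgebra k δ n →ₐ[k] R :=
  AlgHom.ofLinearMap ((basis k δ n).constr k (permValue φ))
    (by
      rw [one_def, Module.Basis.constr_basis, idDiagram, permValue_permDiagram]
      exact map_one φ)
    (by
      set ε := (basis k δ n).constr k (permValue φ) with hε
      have h : (mulHom k δ n).compr₂ ε = (LinearMap.mul k R).compl₁₂ ε ε := by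
        refine (basis k δ n).ext fun d₁ => (basis k δ n).ext fun d₂ => ?_
        simp only [LinearMap.compr₂_apply, mulHom_basis, map_smul, LinearMap.compl₁₂_apply,
          LinearMap.mul_apply', hε, Module.Basis.constr_basis]
        by_cases h₁ : IsPermutation d₁
        · by_cases h₂ : IsPermutation d₂
          · obtain ⟨σ, rfl⟩ := isPermutation_iff.1 h₁
            obtain ⟨τ, rfl⟩ := isPermutation_iff.1 h₂
            rw [midCount_perm_left, pow_zero, one_smul, comp_permDiagram, permValue_permDiagram,
              permValue_permDiagram, permValue_permDiagram, ← map_mul]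
            rfl
          · rw [permValue_eq_zero φ h₂,
              permValue_eq_zero φ fun h => h₂ (isPermutation_comp_iff.1 h).2, smul_zero, mul_zero]
        · rw [permValue_eq_zero φ h₁,
            permValue_eq_zero φ fun h => h₁ (isPermutation_comp_iff.1 h).1, smul_zero, zero_mul]
      exact fun x y => LinearMap.congr_fun (LinearMap.congr_fun h x) y)

theorem permLift_permDiagram (σ : Equiv.Perm (Fin n)) :
    permLift (δ := δ) φ (basis k δ n (permDiagram σ)) = φ (op σ) :=
  ((basis k δ n).constr_basis k _ _).trans (permValue_permDiagram φ σ)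

theorem permLift_eq_zero {d : Diagram n} (hd : ¬ IsPermutation d) :
    permLift (δ := δ) φ (basis k δ n d) = 0 :=
  ((basis k δ n).constr_basis k _ _).trans (permValue_eq_zero φ hd)

theorem augmentation_permDiagram (σ : Equiv.Perm (Fin n)) :
    augmentation k δ n (basis k δ n (permDiagram σ)) = 1 :=
  ((basis k δ n).constr_basis k _ _).trans (if_pos (isPermutation_permDiagram σ))

theorem augmentation_eq_zero {d : Diagram n} (hd : ¬ IsPermutation d) :
    augmentation k δ n (basis k δ n d) = 0 :=
  ((basis k δ n).constr_basis k _ _).trans (if_neg hd)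

/-- The augmentation of `P_n(δ)` factors through `permLift φ`, if some linear form is `1` on the
image of `φ`. -/
theorem map_permLift (L : R →ₗ[k] k) (hL : ∀ g, L (φ g) = 1) (x : PartitionAlgebra k δ n) :
    L (permLift φ x) = augmentation k δ n x := by
  have h : L ∘ₗ (permLift (δ := δ) φ).toLinearMap = (augmentation k δ n).toLinearMap := by
    refine (basis k δ n).ext fun d => ?_
    simp only [LinearMap.comp_apply, AlgHom.toLinearMap_apply]
    by_cases hd : IsPermutation d
    · obtain ⟨σ, rfl⟩ := isPermutation_iff.1 hd
      rw [permLift_permDiagram, augmentation_permDiagram, hL]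
    · rw [permLift_eq_zero φ hd, augmentation_eq_zero hd, map_zero]
  exact LinearMap.congr_fun h x

end permLift

/-! ### The idempotent complementary to the non-permutation diagrams -/

/-- Both products are the diagram of the join of `s` and `t`. -/
theorem commute_mergeDiagram (s t : Setoid (Fin n)) :
    Commute (basis k δ n (mergeDiagram s)) (basis k δ n (mergeDiagram t)) := by
  rw [Commute, SemiconjBy, basis_mul, basis_mul, midCount_mergeDiagram_left,
    midCount_mergeDiagram_left, comp_mergeDiagram, comp_mergeDiagram, sup_comm]

theorem finite_setoid (α : Type*) [Finite α] : Finite (Setoid α) :=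
  Finite.of_injective (fun s : Setoid α => s.r) fun _ _ h =>
    Setoid.ext fun a b => iff_of_eq (congrFun (congrFun h a) b)

/-- The finite set of partitions of `{1, …, n}` with a block of more than one element. -/
noncomputable def nontrivialPartitions (n : ℕ) : Finset (Setoid (Fin n)) :=
  have := finite_setoid (Fin n)
  (Set.toFinite {s : Setoid (Fin n) | s ≠ ⊥}).toFinset

theorem mem_nontrivialPartitions {s : Setoid (Fin n)} : s ∈ nontrivialPartitions n ↔ s ≠ ⊥ := by
  simp [nontrivialPartitions]

theorem pairwise_commute_one_sub_mergeDiagram (S : Set (Setoid (Fin n))) :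
    S.Pairwise (Function.onFun Commute fun s => 1 - basis k δ n (mergeDiagram s)) :=
  fun s _ t _ _ => (Commute.one_left _).sub_left
    ((Commute.one_right _).sub_right (commute_mergeDiagram s t))

/-- The element `∏ (1 - e_s)`, where `e_s` is the diagram of the partition `s` and `s` runs through
the partitions with a block of more than one element.  For a diagram `d` and this
element `f`, one has `d f = 0` if two right vertices of `d` are connected, and `f d = 0` if two left
vertices are. -/
noncomputable def permIdempotent (k : Type u) [CommRing k] (δ : k) (n : ℕ) :
    PartitionAlgebra k δ n :=
  (nontrivialPartitions n).noncommProd (fun s => 1 - basis k δ n (mergeDiagram s))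
    (pairwise_commute_one_sub_mergeDiagram _)

/-- Every factor `1 - e_s` is sent to `1`, as `e_s` is not a permutation diagram. -/
theorem permLift_permIdempotent {R : Type*} [Ring R] [Algebra k R]
    (φ : (Equiv.Perm (Fin n))ᵐᵒᵖ →* R) : permLift φ (permIdempotent k δ n) = 1 := by
  rw [permIdempotent, Finset.map_noncommProd]
  refine (Finset.noncommProd_eq_pow_card _ _ _ 1 fun s hs => ?_).trans (one_pow _)
  rw [map_sub, map_one, permLift_eq_zero φ
    (not_isPermutation_mergeDiagram (mem_nontrivialPartitions.1 hs)), sub_zero]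

/-- If `s` is the partition that `d` induces on its right column, then `d e_s = d`, so that the
factor `1 - e_s` annihilates `d`. -/
theorem basis_mul_permIdempotent {d : Diagram n} (hd : d.comap Sum.inr ≠ ⊥) :
    basis k δ n d * permIdempotent k δ n = 0 := by
  classical
  rw [permIdempotent, ← Finset.mul_noncommProd_erase _ (mem_nontrivialPartitions.2 hd), ← mul_assoc,
    mul_sub, mul_one, basis_mul, midCount_mergeDiagram_right, comp_mergeDiagram_right le_rfl,
    pow_zero, one_smul, sub_self, zero_mul]

/-- If `s` is the partition that `d` induces on its left column, then `e_s d = d`, so that the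
factor `1 - e_s` annihilates `d`. -/
theorem permIdempotent_mul_basis {d : Diagram n} (hd : d.comap Sum.inl ≠ ⊥) :
    permIdempotent k δ n * basis k δ n d = 0 := by
  classical
  rw [permIdempotent, ← Finset.noncommProd_erase_mul _ (mem_nontrivialPartitions.2 hd), mul_assoc,
    sub_mul, one_mul, basis_mul, midCount_mergeDiagram_left, comp_mergeDiagram_left le_rfl,
    pow_zero, one_smul, sub_self, mul_zero]

end PartitionAlgebra

end TanabeCohomology

namespace TanabeCohomology

open CategoryTheory TensorProduct MulOpposite

/-! ### Inflation of representations along a map to the group algebra -/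

/-- Let `φ : R → S` be surjective and let `f` be an element over `1` that is annihilated by the
kernel of `φ` from the left.  Then `s ↦ r f`, where `φ r = s`, is an `R`-linear section of `φ`; so
`S` is projective over `R`, and with it all projective `S`-modules. -/
theorem projective_of_ker_mul_eq_zero {R S M : Type*} [Ring R] [Ring S] (φ : R →+* S)
    (hφ : Function.Surjective φ) (f : R) (hf : φ f = 1) (hker : ∀ b, φ b = 0 → b * f = 0)
    [AddCommGroup M] [Module R M] [Module S M] (hsmul : ∀ (r : R) (m : M), r • m = φ r • m)
    [Module.Projective S M] : Module.Projective R M := by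
  let _ : Module R S := Module.compHom S φ
  have hsm : ∀ (r : R) (s : S), r • s = φ r * s := fun _ _ => rfl
  have hlift : ∀ b c, φ b = φ c → b * f = c * f := fun b c h => by
    rw [← sub_eq_zero, ← sub_mul]
    exact hker _ (by rw [map_sub, h, sub_self])
  have hinv : ∀ s, φ (Function.surjInv hφ s) = s := Function.surjInv_eq hφ
  have hS : Module.Projective R S := by
    let i : S →ₗ[R] R :=
      { toFun := fun s => Function.surjInv hφ s * f
        map_add' := fun s t => by
          rw [← add_mul]
          exact hlift _ _ (by simp only [map_add, hinv])
        map_smul' := fun r s => by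
          rw [RingHom.id_apply, smul_eq_mul, ← mul_assoc]
          exact hlift _ _ (by simp only [map_mul, hinv, hsm]) }
    let p : R →ₗ[R] S :=
      { toFun := φ
        map_add' := map_add φ
        map_smul' := fun r s => map_mul φ r s }
    refine Module.Projective.of_split i p (LinearMap.ext fun s => ?_)
    change φ (Function.surjInv hφ s * f) = s
    rw [map_mul, hf, mul_one, hinv]
  classical
  have hfree : Module.Projective R (M →₀ S) :=
    Module.Projective.of_equiv (finsuppLequivDFinsupp R).symm
  obtain ⟨s, hs⟩ := Module.projective_def'.1 ‹Module.Projective S M›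
  -- A splitting of the free `S`-module on `M` onto `M` is also a splitting over `R`.
  let s' : M →ₗ[R] (M →₀ S) :=
    { toFun := s
      map_add' := map_add s
      map_smul' := fun r m => by
        rw [hsmul, map_smul]
        rfl }
  let p' : (M →₀ S) →ₗ[R] M :=
    { toFun := Finsupp.linearCombination S id
      map_add' := map_add _
      map_smul' := fun r m => by
        rw [RingHom.id_apply, hsmul, ← map_smul]
        rfl }
  exact Module.Projective.of_split s' p' (LinearMap.ext fun m => LinearMap.congr_fun hs m)

section Inflation

variable {k : Type u} [CommRing k] {G : Type u} [Group G] {B : Type u} [Ring B] [Algebra k B]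

/-- A representation of `G`, viewed as a `B`-module through `π : B →ₐ[k] k[G]`. -/
noncomputable def inflation (π : B →ₐ[k] MonoidAlgebra k G) : Rep.{u} k G ⥤ ModuleCat.{u} B :=
  Rep.toModuleMonoidAlgebra ⋙ ModuleCat.restrictScalars π.toRingHom

variable (π : B →ₐ[k] MonoidAlgebra k G)

instance : (inflation π).Additive := by
  have : (Rep.toModuleMonoidAlgebra (k := k) (G := G)).Additive := ⟨rfl⟩
  unfold inflation
  infer_instance

instance : (inflation π).PreservesHomology := by
  have h : ∀ S : ShortComplex (ModuleCat.{u} (MonoidAlgebra k G)), S.Exact →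
      (S.map (ModuleCat.restrictScalars.{u} π.toRingHom)).Exact := fun S hS => by
    rw [ShortComplex.ShortExact.moduleCat_exact_iff_function_exact] at hS ⊢
    exact hS
  obtain ⟨_, _⟩ :=
    ((Functor.exact_tfae (ModuleCat.restrictScalars.{u} π.toRingHom)).out 1 3).mp h
  have : Limits.PreservesFiniteLimits (inflation π) :=
    Limits.comp_preservesFiniteLimits _ (ModuleCat.restrictScalars.{u} π.toRingHom)
  have : Limits.PreservesFiniteColimits (inflation π) :=
    Limits.comp_preservesFiniteColimits _ (ModuleCat.restrictScalars.{u} π.toRingHom)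
  infer_instance

theorem inflation_preservesProjectiveObjects (hπ : Function.Surjective π) (f : B) (hf : π f = 1)
    (hker : ∀ b, π b = 0 → b * f = 0) : (inflation π).PreservesProjectiveObjects where
  projective_obj {V} hV := by
    have h1 : Projective (Rep.toModuleMonoidAlgebra.obj V) :=
      Rep.equivalenceModuleMonoidAlgebra.map_projective_iff V |>.2 hV
    have h2 : Module.Projective (MonoidAlgebra k G) V.ρ.asModule :=
      (IsProjective.iff_projective _).2 h1
    let _ : Module B V.ρ.asModule := Module.compHom _ π.toRingHom
    have h3 : Module.Projective B V.ρ.asModule :=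
      projective_of_ker_mul_eq_zero π.toRingHom hπ f hf hker
        (fun _ _ => rfl) (S := MonoidAlgebra k G)
    exact (IsProjective.iff_projective V.ρ.asModule).1 h3

open ModuleCat.Algebra in
/-- The identity map from the inflation of `V` to `V`, which is `k`-linear. -/
noncomputable def inflationEquiv (V : Rep.{u} k G) : (inflation π).obj V ≃ₗ[k] V :=
  { V.ρ.asModuleEquiv.toAddEquiv with
    map_smul' := fun r v => by
      rw [RingHom.id_apply]
      change V.ρ.asAlgebraHom (π (algebraMap k B r)) _ = _
      rw [AlgHom.commutes, AlgHom.commutes]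
      rfl }

theorem inflationEquiv_smul (V : Rep.{u} k G) (b : B) (v : (inflation π).obj V) :
    inflationEquiv π V (b • v) = V.ρ.asAlgebraHom (π b) (inflationEquiv π V v) := rfl

/-- The augmentation `∑ c_g g ↦ ∑ c_g` of the group algebra. -/
noncomputable def groupAugmentation (k : Type u) [CommRing k] (G : Type u) [Group G] :
    MonoidAlgebra k G →ₐ[k] k :=
  MonoidAlgebra.lift k k G 1

theorem asAlgebraHom_trivial (r : MonoidAlgebra k G) (x : k) :
    (Representation.trivial k G k).asAlgebraHom r x = groupAugmentation k G r * x := by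
  induction r using MonoidAlgebra.induction_linear with
  | zero => simp
  | add a b ha hb => rw [map_add, LinearMap.add_apply, ha, hb, map_add, add_mul]
  | single g c => simp [groupAugmentation, Representation.asAlgebraHom_single]

open ModuleCat.Algebra in
/-- A `B`-module with underlying group `k` on which `B` acts through the augmentation of `k[G]`
is the inflation of the trivial representation. -/
noncomputable def isoInflationTrivial (Y : ModuleCat.{u} B) (e : Y ≃+ k)
    (he : ∀ (b : B) (y : Y), e (b • y) = groupAugmentation k G (π b) * e y) :
    Y ≅ (inflation π).obj (Rep.trivial k G k) :=
  (AddEquiv.toLinearEquiv (e.trans (inflationEquiv π (Rep.trivial k G k)).symm.toAddEquiv)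
    fun b y => by
      refine (inflationEquiv π (Rep.trivial k G k)).injective ?_
      exact (he b y).trans (asAlgebraHom_trivial (π b) (e y)).symm).toModuleIso

/-! ### Tor over an algebra that maps onto the group algebra -/

/-- In the coinvariants of `k ⊗ V`, the group algebra acts in the same way on both factors. -/
theorem aug_mul_tmul_sub_mem_ker (V : Rep.{u} k G) (r : MonoidAlgebra k G) (x : k) (v : V) :
    (groupAugmentation k G r * x) ⊗ₜ[k] v - x ⊗ₜ[k] V.ρ.asAlgebraHom r v ∈
      Representation.Coinvariants.ker ((Representation.trivial k G k).tprod V.ρ) := by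
  induction r using MonoidAlgebra.induction_linear with
  | zero => simp
  | add a b ha hb =>
    rw [map_add, map_add, LinearMap.add_apply, add_mul, add_tmul, tmul_add, add_sub_add_comm]
    exact Submodule.add_mem _ ha hb
  | single g c =>
    have h := Submodule.smul_mem _ (-c)
      (Representation.Coinvariants.sub_mem_ker (ρ := (Representation.trivial k G k).tprod V.ρ) g
        (x ⊗ₜ[k] v))
    convert h using 1
    simp [groupAugmentation, Representation.asAlgebraHom_single, smul_sub, smul_tmul']
    abel

open ModuleCat.Algebra in
/-- `𝟙 ⊗_B V = (k ⊗_k V)_G` for a representation `V` of `G`, viewed as a `B`-module. -/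
noncomputable def tensorInflationEquiv (hπ : Function.Surjective π) (X : ModuleCat.{u} Bᵐᵒᵖ)
    (e : X ≃ₗ[k] k) (he : ∀ (b : B) (x : X), e (op b • x) = groupAugmentation k G (π b) * e x)
    (V : Rep.{u} k G) :
    ((X ⊗[k] (inflation π).obj V) ⧸ balancedRelations k B X ((inflation π).obj V)) ≃ₗ[k]
      ((Representation.trivial k G k).tprod V.ρ).Coinvariants :=
  Submodule.Quotient.equiv _ (Representation.Coinvariants.ker _)
    (TensorProduct.congr e (inflationEquiv π V)) (by
      refine le_antisymm (Submodule.map_le_iff_le_comap.2 (Submodule.span_le.2 ?_))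
        (Submodule.span_le.2 ?_)
      · rintro _ ⟨x, b, m, rfl⟩
        have h := aug_mul_tmul_sub_mem_ker V (π b) (e x) (inflationEquiv π V m)
        rw [← he, ← inflationEquiv_smul] at h
        simpa using h
      · rintro _ ⟨⟨g, t⟩, rfl⟩
        -- An element `b` over `g` acts on `V` as `g` and trivially on `X`.
        obtain ⟨b, hb⟩ := hπ (MonoidAlgebra.of k G g)
        induction t with
        | zero =>
          simp only [map_zero, sub_zero]
          exact Submodule.zero_mem _
        | add s t hs ht =>
          simp only [map_add, add_sub_add_comm]
          exact Submodule.add_mem _ hs ht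
        | tmul x v =>
          refine ⟨-((op b • e.symm x) ⊗ₜ[k] (inflationEquiv π V).symm v -
            (e.symm x) ⊗ₜ[k] (b • (inflationEquiv π V).symm v)),
            Submodule.neg_mem _ (Submodule.subset_span ⟨_, _, _, rfl⟩), ?_⟩
          simp [he, hb, inflationEquiv_smul, groupAugmentation])

open ModuleCat.Algebra in
/-- Tensoring the inflation of a representation with `𝟙` is taking coinvariants. -/
noncomputable def inflationCompTensorFunctorIso (hπ : Function.Surjective π)
    (X : ModuleCat.{u} Bᵐᵒᵖ) (e : X ≃ₗ[k] k)
    (he : ∀ (b : B) (x : X), e (op b • x) = groupAugmentation k G (π b) * e x) :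
    inflation π ⋙ tensorFunctor k B X ≅ (Rep.coinvariantsTensor k G).obj (Rep.trivial k G k) :=
  NatIso.ofComponents (fun V => (tensorInflationEquiv π hπ X e he V).toModuleIso)
    (fun _ => ModuleCat.hom_ext (Submodule.linearMap_qext _ (TensorProduct.ext' fun _ _ => rfl)))

open ModuleCat.Algebra in
/-- Inflation sends the bar resolution of the trivial representation to a projective resolution
over `B`, and tensoring the latter with `𝟙` gives the coinvariants of the former. -/
theorem nonempty_torModule_iso (hπ : Function.Surjective π) (f : B) (hf : π f = 1)
    (hker : ∀ b, π b = 0 → b * f = 0) (X : ModuleCat.{u} Bᵐᵒᵖ) (e : X ≃ₗ[k] k)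
    (he : ∀ (b : B) (x : X), e (op b • x) = groupAugmentation k G (π b) * e x)
    (Y : ModuleCat.{u} B) (e' : Y ≃+ k)
    (he' : ∀ (b : B) (y : Y), e' (b • y) = groupAugmentation k G (π b) * e' y) (i : ℕ) :
    Nonempty (torModule k B X Y i ≅ groupHomology (Rep.trivial k G k) i) := by
  classical
  have := inflation_preservesProjectiveObjects π hπ f hf hker
  let P := Rep.barResolution k G
  let Q := (inflation π).mapProjectiveResolution P
  exact ⟨((tensorFunctor k B X).leftDerived i).mapIso (isoInflationTrivial π Y e' he') ≪≫
    Q.isoLeftDerivedObj _ i ≪≫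
    (HomologicalComplex.homologyFunctor _ _ i).mapIso
      ((NatIso.mapHomologicalComplex (inflationCompTensorFunctorIso π hπ X e he) _).app
        P.complex) ≪≫
    (groupHomologyIso _ i P).symm⟩

/-! ### Ext over an algebra that maps onto the group algebra -/

open ModuleCat.Algebra in
/-- As `π` is surjective, `B`-linear maps between inflations are maps of representations. -/
noncomputable def inflationHomEquiv (hπ : Function.Surjective π) (V W : Rep.{u} k G) :
    ((inflation π).obj V ⟶ (inflation π).obj W) ≃ₗ[k] (V ⟶ W) where
  toFun φ := Rep.ofHom
    { (inflationEquiv π W).toLinearMap ∘ₗ (φ.hom.restrictScalars k) ∘ₗ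
        (inflationEquiv π V).symm.toLinearMap with
      isIntertwining' := fun g => by
        obtain ⟨b, hb⟩ := hπ (MonoidAlgebra.of k G g)
        have h : ∀ (U : Rep.{u} k G) u,
            U.ρ g (inflationEquiv π U u) = inflationEquiv π U (b • u) := by
          intro U u
          rw [inflationEquiv_smul, hb, MonoidAlgebra.of_apply, Representation.asAlgebraHom_single,
            one_smul]
        ext v
        obtain ⟨u, rfl⟩ := (inflationEquiv π V).surjective v
        simp only [LinearMap.comp_apply, LinearEquiv.coe_coe, h, LinearEquiv.symm_apply_apply]
        exact congrArg (inflationEquiv π W) (map_smul φ.hom b u) }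
  invFun f := (inflation π).map f
  map_add' _ _ := rfl
  map_smul' r φ := Rep.hom_ext (by
    ext v
    exact map_smul (inflationEquiv π W) r _)
  left_inv _ := rfl
  right_inv _ := rfl

open ModuleCat.Algebra in
/-- Inflation sends the bar resolution of the trivial representation to a projective resolution
over `B`, and is fully faithful. -/
theorem nonempty_extModule_iso (hπ : Function.Surjective π) (f : B) (hf : π f = 1)
    (hker : ∀ b, π b = 0 → b * f = 0)
    (Y : ModuleCat.{u} B) (e : Y ≃+ k)
    (he : ∀ (b : B) (y : Y), e (b • y) = groupAugmentation k G (π b) * e y) (i : ℕ) :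
    Nonempty (extModule k B Y Y i ≅ groupCohomology (Rep.trivial k G k) i) := by
  classical
  have := inflation_preservesProjectiveObjects π hπ f hf hker
  let P := Rep.barResolution k G
  let Q := (inflation π).mapProjectiveResolution P
  let j := isoInflationTrivial π Y e he
  let T := Rep.trivial k G k
  let c : Q.complex.linearYonedaObj k ((inflation π).obj T) ≅ P.complex.linearYonedaObj k T :=
    HomologicalComplex.Hom.isoOfComponents
      (fun m => (inflationHomEquiv π hπ (P.complex.X m) T).toModuleIso) fun a b _ =>
        ModuleCat.hom_ext (LinearMap.ext fun φ => by
          simp [ChainComplex.linearYonedaObj_d]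
          rfl)
  exact ⟨((Ext k (ModuleCat.{u} B) i).mapIso j.symm.op).app Y ≪≫
    ((Ext k (ModuleCat.{u} B) i).obj _).mapIso j ≪≫
    Q.isoExt i _ ≪≫ (HomologicalComplex.homologyFunctor _ _ i).mapIso c ≪≫
    (groupCohomologyIso _ i P).symm⟩

end Inflation

end TanabeCohomology

namespace TanabeCohomology

open CategoryTheory MulOpposite

namespace PartitionAlgebra

/-! ### Algebras spanned by diagrams -/

section

variable {k : Type u} [CommRing k] {δ : k} {n : ℕ} {p : Diagram n → Prop}
  {hone : p (idDiagram n)} {hmul : ∀ d₁ d₂, p d₁ → p d₂ → p (comp d₁ d₂)}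

theorem basis_mem_spanSubalgebra {d : Diagram n} (hd : p d) :
    basis k δ n d ∈ spanSubalgebra k δ n p hone hmul :=
  Submodule.subset_span ⟨d, hd, rfl⟩

theorem permIdempotent_mem_spanSubalgebra (hmerge : ∀ s, p (mergeDiagram s)) :
    permIdempotent k δ n ∈ spanSubalgebra k δ n p hone hmul :=
  Submonoid.noncommProd_mem (spanSubalgebra k δ n p hone hmul).toSubmonoid _ _ _ fun s _ =>
    Subalgebra.sub_mem _ (Subalgebra.one_mem _) (basis_mem_spanSubalgebra (hmerge s))

theorem eqOn_spanSubalgebra {M : Type*} [AddCommGroup M] [Module k M]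
    {f g : PartitionAlgebra k δ n →ₗ[k] M} (h : ∀ d, p d → f (basis k δ n d) = g (basis k δ n d))
    {x : PartitionAlgebra k δ n} (hx : x ∈ spanSubalgebra k δ n p hone hmul) : f x = g x :=
  LinearMap.eqOn_span (s := basis k δ n '' {d | p d}) (by rintro _ ⟨d, hd, rfl⟩; exact h d hd) hx

variable (k n) in
/-- `σ ↦ σ⁻¹`, as a homomorphism from the opposite of `Σ_n` to the group algebra of `Σ_n`. -/
noncomputable def invHom :
    (Equiv.Perm (Fin n))ᵐᵒᵖ →* MonoidAlgebra k (ULift.{u} (Equiv.Perm (Fin n))) :=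
  (MonoidAlgebra.of k _).comp (MulEquiv.ulift.symm.toMonoidHom.comp
    (MulEquiv.inv' (Equiv.Perm (Fin n))).symm.toMonoidHom)

variable (k n) in
/-- The opposite of the inclusion of `Σ_n` in its group algebra. -/
noncomputable def opHom :
    (Equiv.Perm (Fin n))ᵐᵒᵖ →* (MonoidAlgebra k (ULift.{u} (Equiv.Perm (Fin n))))ᵐᵒᵖ :=
  MonoidHom.op ((MonoidAlgebra.of k _).comp MulEquiv.ulift.symm.toMonoidHom)

theorem invHom_op (σ : Equiv.Perm (Fin n)) : invHom k n (op σ) = .of k _ ⟨σ⁻¹⟩ := rfl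

/-- Let `f = ∏ (1 - e_s)`.  As `f` is annihilated by the non-permutation diagrams, `x f` depends
only on the part of `x` in permutation diagrams, which can be recovered from `permLift φ x` if `φ`
has a linear retraction `L`. -/
theorem mul_permIdempotent_eq_zero
    (hright : ∀ d, p d → d.comap Sum.inr = ⊥ → IsPermutation d)
    {R : Type*} [Ring R] [Algebra k R] (φ : (Equiv.Perm (Fin n))ᵐᵒᵖ →* R)
    (L : R →ₗ[k] PartitionAlgebra k δ n) (hL : ∀ σ, L (φ (op σ)) = basis k δ n (permDiagram σ))
    {x : PartitionAlgebra k δ n} (hx : x ∈ spanSubalgebra k δ n p hone hmul)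
    (h : permLift φ x = 0) : x * permIdempotent k δ n = 0 := by
  have key := eqOn_spanSubalgebra (f := LinearMap.mulRight k (permIdempotent k δ n))
    (g := LinearMap.mulRight k (permIdempotent k δ n) ∘ₗ L ∘ₗ (permLift φ).toLinearMap)
    (fun d hd => by
      simp only [LinearMap.comp_apply, LinearMap.mulRight_apply, AlgHom.toLinearMap_apply]
      by_cases hd' : IsPermutation d
      · obtain ⟨σ, rfl⟩ := isPermutation_iff.1 hd'
        rw [permLift_permDiagram, hL]
      · rw [permLift_eq_zero φ hd', map_zero, zero_mul,
          basis_mul_permIdempotent fun hb => hd' (hright d hd hb)]) hx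
  simpa [h] using key

/-- The mirror image of `mul_permIdempotent_eq_zero`. -/
theorem permIdempotent_mul_eq_zero
    (hleft : ∀ d, p d → d.comap Sum.inl = ⊥ → IsPermutation d)
    {R : Type*} [Ring R] [Algebra k R] (φ : (Equiv.Perm (Fin n))ᵐᵒᵖ →* R)
    (L : R →ₗ[k] PartitionAlgebra k δ n) (hL : ∀ σ, L (φ (op σ)) = basis k δ n (permDiagram σ))
    {x : PartitionAlgebra k δ n} (hx : x ∈ spanSubalgebra k δ n p hone hmul)
    (h : permLift φ x = 0) : permIdempotent k δ n * x = 0 := by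
  have key := eqOn_spanSubalgebra (f := LinearMap.mulLeft k (permIdempotent k δ n))
    (g := LinearMap.mulLeft k (permIdempotent k δ n) ∘ₗ L ∘ₗ (permLift φ).toLinearMap)
    (fun d hd => by
      simp only [LinearMap.comp_apply, LinearMap.mulLeft_apply, AlgHom.toLinearMap_apply]
      by_cases hd' : IsPermutation d
      · obtain ⟨σ, rfl⟩ := isPermutation_iff.1 hd'
        rw [permLift_permDiagram, hL]
      · rw [permLift_eq_zero φ hd', map_zero, mul_zero,
          permIdempotent_mul_basis fun hb => hd' (hleft d hd hb)]) hx
  simpa [h] using key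

/-- The linear extension to the group algebra of a function on the group. -/
noncomputable def linearExtension {G M : Type*} [AddCommGroup M] [Module k M] (v : G → M) :
    MonoidAlgebra k G →ₗ[k] M :=
  Finsupp.linearCombination k v ∘ₗ (MonoidAlgebra.coeffLinearEquiv k).toLinearMap

theorem linearExtension_of {G M : Type*} [Monoid G] [AddCommGroup M] [Module k M] (v : G → M)
    (g : G) :
    linearExtension (k := k) v (MonoidAlgebra.of k G g) = v g := by
  simp [linearExtension]

theorem permLift_surjective (hperm : ∀ σ, p (permDiagram σ)) {G : Type*} [Group G]
    {R : Type*} [Ring R] [Algebra k R] (φ : (Equiv.Perm (Fin n))ᵐᵒᵖ →* R)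
    (T : MonoidAlgebra k G →ₗ[k] R) (hT : ∀ g, T (.of k G g) ∈ Set.range φ)
    (hsurj : Function.Surjective T) :
    Function.Surjective ((permLift φ).comp (spanSubalgebra k δ n p hone hmul).val) := by
  intro y
  obtain ⟨y, rfl⟩ := hsurj y
  induction y using MonoidAlgebra.induction_on with
  | of g =>
    obtain ⟨σ, hσ⟩ := hT g
    refine ⟨⟨_, basis_mem_spanSubalgebra (hperm σ.unop)⟩, ?_⟩
    exact (permLift_permDiagram φ _).trans hσ
  | add x y hx hy =>
    obtain ⟨a, ha⟩ := hx
    obtain ⟨b, hb⟩ := hy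
    exact ⟨a + b, by rw [map_add, map_add, ha, hb]⟩
  | smul r x hx =>
    obtain ⟨a, ha⟩ := hx
    exact ⟨r • a, by rw [map_smul, map_smul, ha]⟩

open ModuleCat.Algebra in
/-- For homology, `𝟙` is resolved by left modules, so the non-permutation diagrams have to
annihilate the idempotent from the left: they need two connected vertices on the right. -/
theorem nonempty_augHomology_iso (hperm : ∀ σ, p (permDiagram σ))
    (hmerge : ∀ s, p (mergeDiagram s))
    (hright : ∀ d, p d → d.comap Sum.inr = ⊥ → IsPermutation d) (i : ℕ) :
    Nonempty (augHomology (subAugmentation (spanSubalgebra k δ n p hone hmul)) i ≅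
        symmHomology k n i) := by
  let A := spanSubalgebra k δ n p hone hmul
  let π : A →ₐ[k] MonoidAlgebra k (ULift.{u} (Equiv.Perm (Fin n))) :=
    (permLift (invHom k n)).comp A.val
  have hε : ∀ a : A, groupAugmentation k _ (π a) = subAugmentation A a := fun a =>
    map_permLift (invHom k n) (groupAugmentation k _).toLinearMap
      (fun g => by simp [invHom, groupAugmentation]) a.1
  have hπ : Function.Surjective π :=
    permLift_surjective hperm (invHom k n) LinearMap.id
      (fun g => ⟨op g.down⁻¹, by rw [invHom_op, inv_inv]; rfl⟩) Function.surjective_id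
  refine nonempty_torModule_iso π hπ
    ⟨permIdempotent k δ n, permIdempotent_mem_spanSubalgebra hmerge⟩
    (permLift_permIdempotent _)
    (fun a ha => Subtype.ext (mul_permIdempotent_eq_zero hright (invHom k n)
      (linearExtension fun g => basis k δ n (permDiagram g.down⁻¹))
      (fun σ => by rw [invHom_op, linearExtension_of, inv_inv]) a.2 ha))
    (trivialRight (subAugmentation A))
    (AddEquiv.toLinearEquiv (AddEquiv.refl k) fun r x => ?_) (fun b x => ?_)
    (trivialLeft (subAugmentation A)) (AddEquiv.refl k) (fun b x => ?_) i
  · exact congrArg (· * (show k from x)) ((subAugmentation A).commutes r)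
  · exact congrArg (· * (show k from x)) (hε b).symm
  · exact congrArg (· * (show k from x)) (hε b).symm

/-- For cohomology, `𝟙` is resolved by right modules, so the non-permutation diagrams have to
annihilate the idempotent from the right: they need two connected vertices on the left. -/
theorem nonempty_augCohomology_iso (hperm : ∀ σ, p (permDiagram σ))
    (hmerge : ∀ s, p (mergeDiagram s))
    (hleft : ∀ d, p d → d.comap Sum.inl = ⊥ → IsPermutation d) (i : ℕ) :
    Nonempty (augCohomology (subAugmentation (spanSubalgebra k δ n p hone hmul)) i ≅
        symmCohomology k n i) := by
  let A := spanSubalgebra k δ n p hone hmul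
  let π₀ : A →ₐ[k] (MonoidAlgebra k (ULift.{u} (Equiv.Perm (Fin n))))ᵐᵒᵖ :=
    (permLift (opHom k n)).comp A.val
  let π : Aᵐᵒᵖ →ₐ[k] MonoidAlgebra k (ULift.{u} (Equiv.Perm (Fin n))) := AlgHom.opComm π₀
  have hε : ∀ a : A, groupAugmentation k _ (π (op a)) = subAugmentation A a := fun a =>
    map_permLift (opHom k n)
      ((groupAugmentation k _).toLinearMap ∘ₗ (opLinearEquiv k).symm.toLinearMap)
      (fun g => by simp [opHom, groupAugmentation]) a.1
  have hπ₀ : Function.Surjective π₀ :=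
    permLift_surjective hperm (opHom k n) (opLinearEquiv k).toLinearMap
      (fun g => ⟨op g.down, rfl⟩) (opLinearEquiv k).surjective
  have hπ : Function.Surjective π := unop_surjective.comp (hπ₀.comp unop_surjective)
  refine nonempty_extModule_iso π hπ
    (op ⟨permIdempotent k δ n, permIdempotent_mem_spanSubalgebra hmerge⟩)
    (congrArg unop (permLift_permIdempotent (opHom k n)))
    (fun a ha => unop_injective (Subtype.ext (permIdempotent_mul_eq_zero hleft (opHom k n)
      (linearExtension (fun g => basis k δ n (permDiagram g.down)) ∘ₗ
        (opLinearEquiv k).symm.toLinearMap)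
      (fun σ => linearExtension_of _ _) a.unop.2 (unop_injective ha))))
    (trivialRight (subAugmentation A)) (AddEquiv.refl k) ?_ i
  intro b x
  exact congrArg (· * (show k from x)) (hε b.unop).symm

end

end PartitionAlgebra

end TanabeCohomology

open TanabeCohomology PartitionAlgebra in
theorem mainTheorem1 (k : Type u) [CommRing k] (δ : k) (n r : ℕ) (hr : 2 ≤ r) :
    ((∀ i : ℕ, Nonempty
        (TanabeCohomology.augHomology (TanabeCohomology.PartitionAlgebra.subAugmentation
          (TanabeCohomology.tanabeAlgebra k δ n r)) i ≅ TanabeCohomology.symmHomology k n i)) ∧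
      (∀ i : ℕ, Nonempty
        (TanabeCohomology.augCohomology (TanabeCohomology.PartitionAlgebra.subAugmentation
          (TanabeCohomology.tanabeAlgebra k δ n r)) i ≅ TanabeCohomology.symmCohomology k n i))) ∧
    ((∀ i : ℕ, Nonempty
        (TanabeCohomology.augHomology (TanabeCohomology.PartitionAlgebra.subAugmentation
          (TanabeCohomology.tppAlgebra k δ n)) i ≅ TanabeCohomology.symmHomology k n i)) ∧
      (∀ i : ℕ, Nonempty
        (TanabeCohomology.augCohomology (TanabeCohomology.PartitionAlgebra.subAugmentation
          (TanabeCohomology.tppAlgebra k δ n)) i ≅ TanabeCohomology.symmCohomology k n i))) ∧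
    ((∀ i : ℕ, Nonempty
        (TanabeCohomology.augHomology (TanabeCohomology.PartitionAlgebra.subAugmentation
          (TanabeCohomology.uniformBlockAlgebra k δ n)) i ≅ TanabeCohomology.symmHomology k n i)) ∧
      (∀ i : ℕ, Nonempty
        (TanabeCohomology.augCohomology (TanabeCohomology.PartitionAlgebra.subAugmentation
          (TanabeCohomology.uniformBlockAlgebra k δ n)) i ≅
            TanabeCohomology.symmCohomology k n i))) := by
  have hr' : r ≠ 1 := by omega
  refine ⟨⟨fun i => ?_, fun i => ?_⟩, ⟨fun i => ?_, fun i => ?_⟩, fun i => ?_, fun i => ?_⟩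
  · exact nonempty_augHomology_iso (isTanabe_permDiagram r) (isTanabe_mergeDiagram r)
      (fun _ h => h.isPermutation_of_right hr') i
  · exact nonempty_augCohomology_iso (isTanabe_permDiagram r) (isTanabe_mergeDiagram r)
      (fun _ h => h.isPermutation_of_left hr') i
  · exact nonempty_augHomology_iso isTotallyPropagating_permDiagram
      isTotallyPropagating_mergeDiagram (fun _ h => h.isPermutation_of_right) i
  · exact nonempty_augCohomology_iso isTotallyPropagating_permDiagram
      isTotallyPropagating_mergeDiagram (fun _ h => h.isPermutation_of_left) i
  · exact nonempty_augHomology_iso isUniform_permDiagram isUniform_mergeDiagram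
      (fun _ h => (isUniform_iff.1 h).isPermutation_of_right zero_ne_one) i
  · exact nonempty_augCohomology_iso isUniform_permDiagram isUniform_mergeDiagram
      (fun _ h => (isUniform_iff.1 h).isPermutation_of_left zero_ne_one) i
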